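/- Let $d\in\mathbb N$, $p\in[1,2]$, and let $c$ be a slice permutation of $\{1,\dots,4d\}$, that is, a permutation mapping $\{1,\dots,d\}\cup\{2d+1,\dots,3d\}$ bijectively onto $\{1,\dots,2d\}$ and $\{d+1,\dots,2d\}\cup\{3d+1,\dots,4d\}$ bijectively onto $\{2d+1,\dots,4d\}$; write $\mathfrak c(x_1,\dots,x_{4d})=(x_{c(1)},\dots,x_{c(4d)})$. Fix a nonzero window $\phi\in\mathcal S(\mathbb R^{2d})$ and, for $k\in\mathcal S'(\mathbb R^{2d})$, let $V_\phi k(x,\xi)=\langle k,M_\xi T_x\phi\rangle$ for $x,\xi\in\mathbb R^{2d}$, where $M_\xi T_x\phi(t)=e^{2\pi i t\cdot\xi}\phi(t-x)$ and $\langle\cdot,\cdot\rangle$ extends the $L^2$ inner product (conjugate linear in the second argument). Let $p_1=\dots=p_{2d}=2$ and $p_{2d+1}=\dots=p_{4d}=p$, and suppose that $k$ belongs to the mixed modulation space $M(c)^{p_1,\dots,p_{4d}}$, i.e. $$\biggl(\int_{\mathbb R}\cdots\biggl(\int_{\mathbb R}\bigl|V_\phi k(\mathfrak c(x_1,\dots,x_{4d}))\bigr|^{p_1}\,dx_1\biggr)^{p_2/p_1}\cdots\,dx_{4d}\biggr)^{1/p_{4d}}<\infty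 .$$ Then $k$ is the kernel of an integral operator on $L^2(\mathbb R^d)$, that is, $k$ is given by a function and there is a linear operator $A$ on $L^2(\mathbb R^d)$ with $Af(t)=\int_{\mathbb R^d}k(t,y)f(y)\,dy$ for a.e. $t$, for every $f\in L^2(\mathbb R^d)$; and every such integral operator $A$ with kernel $k$ is Schatten $p$-class on $L^2(\mathbb R^d)$: $$\sup\Bigl(\sum_{n\in\mathbb N}|\langle Af_n,g_n\rangle|^p\Bigr)^{1/p}<\infty,$$ the supremum being over all pairs of orthonormal sequences $\{f_n\}_{n\in\mathbb N}$, $\{g_n\}_{n\in\mathbb N}$ in $L^2(\mathbb R^d)$. -/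

import Mathlib

open MeasureTheory
open scoped ENNReal SchwartzMap

noncomputable section

namespace MixedMod

/-- `ℝⁿ` with its Euclidean structure. -/
abbrev E (n : ℕ) : Type := EuclideanSpace ℝ (Fin n)

/-- The point `(t, y)` of `ℝ^(m+n)` for `t ∈ ℝᵐ` and `y ∈ ℝⁿ`. -/
def pair {m n : ℕ} (t : E m) (y : E n) : E (m + n) :=
  WithLp.toLp 2 (Fin.append (fun i => t i) (fun i => y i))

/-! ### Gabor transform of a tempered distribution -/

/-- The character `t ↦ exp(2πi t·ξ)`. -/
def character {n : ℕ} (ξ : E n) (t : E n) : ℂ :=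
  Complex.exp (2 * Real.pi * Complex.I * ((inner ℝ t ξ : ℝ) : ℂ))

theorem hasTemperateGrowth_cexp_I :
    (fun s : ℝ => Complex.exp ((s : ℂ) * Complex.I)).HasTemperateGrowth := by
  have hd : ∀ n : ℕ, iteratedDeriv n (fun s : ℝ => Complex.exp ((s : ℂ) * Complex.I)) =
      fun s : ℝ => Complex.I ^ n * Complex.exp ((s : ℂ) * Complex.I) := by
    intro n
    induction n with
    | zero => simp
    | succ n ih =>
      rw [iteratedDeriv_succ, ih]
      funext s
      have h1 : HasDerivAt (fun s : ℝ => (s : ℂ) * Complex.I) (1 * Complex.I) s :=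
        (Complex.ofRealCLM.hasDerivAt (x := s)).mul_const Complex.I
      rw [(h1.cexp.const_mul (Complex.I ^ n)).deriv]
      ring
  refine ⟨(Complex.ofRealCLM.contDiff.mul contDiff_const).cexp, fun n => ⟨0, 1, fun s => ?_⟩⟩
  rw [norm_iteratedFDeriv_eq_norm_iteratedDeriv, hd]
  simp [Complex.norm_exp]

theorem hasTemperateGrowth_character {n : ℕ} (ξ : E n) :
    (character ξ).HasTemperateGrowth := by
  have h : character ξ = (fun s : ℝ => Complex.exp ((s : ℂ) * Complex.I)) ∘
      (fun t : E n => (inner ℝ t ((2 * Real.pi) • ξ) : ℝ)) := by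
    funext t
    simp only [character, Function.comp_apply, inner_smul_right]
    congr 1
    push_cast
    ring
  rw [h]
  exact hasTemperateGrowth_cexp_I.comp (Function.hasTemperateGrowth_inner_left _)

/-- The time-frequency shift `M_ξ T_x φ`, that is `t ↦ exp(2πi t·ξ) φ(t - x)`. -/
def timeFreqShift {n : ℕ} (φ : 𝓢(E n, ℂ)) (x ξ : E n) : 𝓢(E n, ℂ) :=
  SchwartzMap.smulLeftCLM ℂ (character ξ) (SchwartzMap.compSubConstCLM ℂ x φ)

theorem timeFreqShift_apply {n : ℕ} (φ : 𝓢(E n, ℂ)) (x ξ t : E n) :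
    timeFreqShift φ x ξ t =
      Complex.exp (2 * Real.pi * Complex.I * ((inner ℝ t ξ : ℝ) : ℂ)) * φ (t - x) := by
  simp [timeFreqShift, hasTemperateGrowth_character ξ, character]

/-- The complex conjugate of a Schwartz function. -/
def conjS {n : ℕ} (φ : 𝓢(E n, ℂ)) : 𝓢(E n, ℂ) :=
  SchwartzMap.postcompCLM (𝕜 := ℝ) (Complex.conjCLE : ℂ →L[ℝ] ℂ) φ

theorem conjS_apply {n : ℕ} (φ : 𝓢(E n, ℂ)) (t : E n) :
    conjS φ t = (starRingEnd ℂ) (φ t) := rfl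

/-- `V_φ f (x, ξ) = ⟨f, M_ξ T_x φ⟩`. The pairing `⟨f, ψ⟩` extends the `L²` inner product, so it is
conjugate linear in `ψ`: it is the value of the linear functional `f` at the conjugate of `ψ`. -/
def gaborTransform {n : ℕ} (φ : 𝓢(E n, ℂ)) (f : 𝓢'(E n, ℂ)) (x ξ : E n) : ℂ :=
  f (conjS (timeFreqShift φ x ξ))

/-! ### Mixed norms and mixed modulation spaces -/

/-- The mixed norm `‖F‖_{L^{p₁,…,pₙ}}` of a nonnegative function on `ℝⁿ`: the `L^{p₁}` norm in the
first variable is innermost, the `L^{pₙ}` norm in the last variable is outermost. -/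
def mixedNorm : (n : ℕ) → (Fin n → ℝ≥0∞) → ((Fin n → ℝ) → ℝ≥0∞) → ℝ≥0∞
  | 0, _, F => F Fin.elim0
  | n + 1, p, F =>
      mixedNorm n (fun i => p i.succ)
        (fun x => eLpNorm (fun t : ℝ => F (Fin.cons t x)) (p 0) volume)

/-- `V_φ f` as a function on `ℝ²ⁿ`, the time variables being the first `n` coordinates. -/
def gaborTransformFlat {n : ℕ} (φ : 𝓢(E n, ℂ)) (f : 𝓢'(E n, ℂ)) (z : Fin (n + n) → ℝ) : ℂ :=
  gaborTransform φ f (WithLp.toLp 2 (fun i => z (Fin.castAdd n i)))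
    (WithLp.toLp 2 (fun i => z (Fin.natAdd n i)))

/-- The norm of `M(c)^{p₁,…,p₂ₙ}` with window `φ`: the mixed norm of `V_φ f ∘ 𝔠`, where
`𝔠(x₁,…,x₂ₙ) = (x_{c(1)},…,x_{c(2n)})`. -/
def mixedModNorm {n : ℕ} (φ : 𝓢(E n, ℂ)) (c : Equiv.Perm (Fin (n + n)))
    (p : Fin (n + n) → ℝ≥0∞) (f : 𝓢'(E n, ℂ)) : ℝ≥0∞ :=
  mixedNorm (n + n) p (fun x => ‖gaborTransformFlat φ f (fun i => x (c i))‖ₑ)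

/-- The mixed modulation space `M(c)^{p₁,…,p₂ₙ}` on `ℝⁿ`, defined with the window `φ`. -/
def mixedModulationSpace {n : ℕ} (φ : 𝓢(E n, ℂ)) (c : Equiv.Perm (Fin (n + n)))
    (p : Fin (n + n) → ℝ≥0∞) : Set 𝓢'(E n, ℂ) :=
  {f | mixedModNorm φ c p f < ∞}

/-- Slice permutations of `{1,…,4d}` (here, zero-based, of `{0,…,4d-1}`). -/
def IsSlicePermutation (d : ℕ) (c : Equiv.Perm (Fin ((d + d) + (d + d)))) : Prop :=
  Set.BijOn c {i | i.val < d ∨ (2 * d ≤ i.val ∧ i.val < 3 * d)} {j | j.val < 2 * d} ∧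
  Set.BijOn c {i | (d ≤ i.val ∧ i.val < 2 * d) ∨ 3 * d ≤ i.val} {j | 2 * d ≤ j.val}

/-! ### Integral operators and Schatten classes -/

/-- The complex Hilbert space `L²(ℝᵈ)`. -/
abbrev L2 (d : ℕ) : Type := Lp ℂ 2 (volume : Measure (E d))

/-- `A` is the integral operator `A f (t) = ∫ k(t, y) f(y) dy` on `L²(ℝᵈ)`, where the tempered
distribution `k` is the function `K`. -/
def IsIntegralOperator {d : ℕ} (k : 𝓢'(E (d + d), ℂ)) (A : L2 d →ₗ[ℂ] L2 d) : Prop :=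
  ∃ K : E (d + d) → ℂ, AEStronglyMeasurable K volume ∧
    (∀ ψ : 𝓢(E (d + d), ℂ), Integrable (fun z => K z * ψ z) ∧ k ψ = ∫ z, K z * ψ z) ∧
    ∀ f : L2 d, ∀ᵐ t : E d, Integrable (fun y : E d => K (pair t y) * f y) ∧
      (A f : E d → ℂ) t = ∫ y : E d, K (pair t y) * f y

/-- The Schatten norm: the supremum of `(∑ₙ |⟨A fₙ, gₙ⟩|^p)^(1/p)` over all pairs of orthonormal
sequences. -/
def schattenNorm {H : Type*} [NormedAddCommGroup H] [InnerProductSpace ℂ H]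
    (p : ℝ) (A : H →ₗ[ℂ] H) : ℝ≥0∞ :=
  ⨆ (f : ℕ → H) (g : ℕ → H) (_ : Orthonormal ℂ f) (_ : Orthonormal ℂ g),
    (∑' n, ‖(inner ℂ (g n) (A (f n)) : ℂ)‖ₑ ^ p) ^ (1 / p)

/-- `A` is Schatten `p`-class. -/
def IsSchatten {H : Type*} [NormedAddCommGroup H] [InnerProductSpace ℂ H]
    (p : ℝ) (A : H →ₗ[ℂ] H) : Prop :=
  schattenNorm p A < ∞

end MixedMod

end

/-! ### Translations and modulations on Schwartz space -/

namespace MixedMod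

open Filter Topology FourierTransform

noncomputable section

section Translation

/-! Write `V` for the Gabor transform of `k` and group its variables as `v = (x, ξ)`, belonging to
the output variable of the kernel, and `z = (y, η)`, belonging to the input variable. The slice
condition says exactly that `v` fills the inner `L²` block of the mixed norm and `z` the outer `L^p`
block, so the hypothesis reads `∫ (∫ |V(v,z)|² dv)^(p/2) dz < ∞`
(`lintegral_gaborTransform_mixPoint_lt_top`).

Choose a window `γ = γ₁ ⊗ γ₂` with `c₀ = ∫ γ conj φ ≠ 0` (`exists_tensor_window`). Let `D_γ ψ(w)` be
the integral of `ψ` against the time-frequency shift of `γ` by `w`. The inversion formula `c₀ k(ψ) =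
∫ V D_γ ψ` holds for Schwartz `ψ` (`integral_gaborTransform_mul_dualGabor`). Since `D_γ ψ` is
bounded in `L^{2,∞}` and in `L^{2,2}` by a multiple of `‖ψ‖₂`, and `p ≤ 2`, the right side is a
bounded functional on `L²` (`exists_bounded_form`). The Riesz theorem then produces an `L²` kernel,
hence an integral operator (`exists_L2_kernel`).

For the Schatten bound, test the functional on `conj g_n ⊗ f_n`. The dual transform factors, and `c₀
⟨A f_n, g_n⟩ = ∫ D_{γ₂} f_n(z) H_n(z) dz` with `H_n(z) = ∫ V(v,z) D_{γ₁}(conj g_n)(v) dv`. Put `u_n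
= |D_{γ₂} f_n|` and `h_n = |H_n|`. Hölder gives `(∫ u_n h_n)^p ≤ (∫ u_n²)^(p-1) ∫ u_n^(2-p) h_n^p`.
Summing under the integral and applying Hölder in `n` leaves `(∑ u_n²)^((2-p)/2) (∑ h_n²)^(p/2)` at
each `z`. Bessel's inequality bounds `∑ u_n(z)²` by a constant and `∑ h_n(z)²` by a multiple of `∫
|V(v,z)|² dv`, so integration in `z` returns the hypothesis (`tsum_lintegral_mul_rpow_le`,
`tsum_enorm_form_rpow_le`). -/

theorem norm_le_one_add_mul_one_add_sub {V : Type*} [NormedAddCommGroup V] (t x : V) : ‖t‖ ≤ (1 + ‖x‖) * (1 + ‖t - x‖) := by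
  have h : ‖t‖ ≤ ‖x‖ + ‖t - x‖ := by
    calc ‖t‖ = ‖x + (t - x)‖ := by congr 1; abel
      _ ≤ _ := norm_add_le _ _
  nlinarith [norm_nonneg x, norm_nonneg (t - x), mul_nonneg (norm_nonneg x) (norm_nonneg (t - x))]

variable {V : Type*} [NormedAddCommGroup V] [NormedSpace ℝ V]

/-- Finite suprema of the Schwartz seminorms are continuous. -/
theorem continuous_sup_seminorm (s : Finset (ℕ × ℕ)) :
    Continuous fun f : 𝓢(V, ℂ) => s.sup (schwartzSeminormFamily ℂ V ℂ) f :=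
  Seminorm.continuous_finsetSup fun i _ => (schwartz_withSeminorms ℂ V ℂ).continuous_seminorm i

theorem iteratedFDeriv_compSubConst (f : 𝓢(V, ℂ)) (n : ℕ) (x t : V) :
    iteratedFDeriv ℝ n (SchwartzMap.compSubConstCLM ℂ x f) t = iteratedFDeriv ℝ n f (t - x) := by
  have : ⇑(SchwartzMap.compSubConstCLM ℂ x f) = fun t => f (t - x) := by
    funext t; simp
  rw [this, iteratedFDeriv_comp_sub]

theorem seminorm_compSubConst_le (m n : ℕ) (f : 𝓢(V, ℂ)) (x : V) :
    SchwartzMap.seminorm ℂ m n (SchwartzMap.compSubConstCLM ℂ x f) ≤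
      (1 + ‖x‖) ^ m * (2 ^ m * (Finset.Iic (m, n)).sup (schwartzSeminormFamily ℂ V ℂ) f) := by
  refine SchwartzMap.seminorm_le_bound ℂ m n _ (by positivity) fun t => ?_
  rw [iteratedFDeriv_compSubConst]
  calc ‖t‖ ^ m * ‖iteratedFDeriv ℝ n f (t - x)‖
      ≤ ((1 + ‖x‖) * (1 + ‖t - x‖)) ^ m * ‖iteratedFDeriv ℝ n f (t - x)‖ := by
        gcongr; exact norm_le_one_add_mul_one_add_sub t x
    _ = (1 + ‖x‖) ^ m * ((1 + ‖t - x‖) ^ m * ‖iteratedFDeriv ℝ n f (t - x)‖) := by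
        rw [mul_pow, mul_assoc]
    _ ≤ _ := by
        refine mul_le_mul_of_nonneg_left ?_ (by positivity)
        exact SchwartzMap.one_add_le_sup_seminorm_apply (𝕜 := ℂ) (m := (m, n)) le_rfl le_rfl f _

/-- Mean value inequality for the `n`-th derivative on the segment from `t - b` to `t - a`. Every
point of that segment is within `‖a‖ + ‖b‖` of `t`, so the weight at `t` is controlled by the weight
at the point. -/
theorem seminorm_compSubConst_sub_le (m n : ℕ) (f : 𝓢(V, ℂ)) (a b : V) :
    SchwartzMap.seminorm ℂ m n
        (SchwartzMap.compSubConstCLM ℂ a f - SchwartzMap.compSubConstCLM ℂ b f) ≤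
      (1 + (‖a‖ + ‖b‖)) ^ m *
        (2 ^ m * (Finset.Iic (m, n + 1)).sup (schwartzSeminormFamily ℂ V ℂ) f) * ‖a - b‖ := by
  refine SchwartzMap.seminorm_le_bound ℂ m n _ (by positivity) fun t => ?_
  have hsub : iteratedFDeriv ℝ n
      (⇑(SchwartzMap.compSubConstCLM ℂ a f - SchwartzMap.compSubConstCLM ℂ b f)) t =
      iteratedFDeriv ℝ n f (t - a) - iteratedFDeriv ℝ n f (t - b) := by
    rw [← iteratedFDeriv_compSubConst, ← iteratedFDeriv_compSubConst, FunLike.coe_sub,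
      iteratedFDeriv_sub_apply ((SchwartzMap.smooth _ n).contDiffAt)
        ((SchwartzMap.smooth _ n).contDiffAt)]
  rw [hsub]
  set M := (1 + (‖a‖ + ‖b‖)) ^ m *
    (2 ^ m * (Finset.Iic (m, n + 1)).sup (schwartzSeminormFamily ℂ V ℂ) f) with hM
  have hM0 : 0 ≤ M := by positivity
  -- The derivative bound below is divided by `‖t‖ ^ m`, so the case where this weight vanishes is
  -- treated apart.
  rcases eq_or_lt_of_le (show 0 ≤ ‖t‖ ^ m by positivity) with h0 | h0
  · rw [← h0, zero_mul]; positivity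
  have hd : Differentiable ℝ (iteratedFDeriv ℝ n f) :=
    (f.smooth (n + 1)).differentiable_iteratedFDeriv (by exact_mod_cast Nat.lt_succ_self n)
  have hbd : ∀ u ∈ segment ℝ (t - b) (t - a),
      ‖fderiv ℝ (iteratedFDeriv ℝ n f) u‖ ≤ M / ‖t‖ ^ m := by
    rintro u ⟨α, β, hα, hβ, hαβ, rfl⟩
    set u := α • (t - b) + β • (t - a) with hu
    have htu : ‖t - u‖ ≤ ‖a‖ + ‖b‖ := by
      have : t - u = α • b + β • a := by
        have : t = α • t + β • t := by rw [← add_smul, hαβ, one_smul]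
        rw [hu, smul_sub, smul_sub]
        nth_rewrite 1 [this]
        abel
      rw [this]
      refine (norm_add_le _ _).trans ?_
      rw [norm_smul, norm_smul, Real.norm_of_nonneg hα, Real.norm_of_nonneg hβ]
      nlinarith [norm_nonneg a, norm_nonneg b]
    rw [norm_fderiv_iteratedFDeriv, le_div_iff₀ h0, mul_comm]
    calc ‖t‖ ^ m * ‖iteratedFDeriv ℝ (n + 1) f u‖
        ≤ ((1 + (‖a‖ + ‖b‖)) * (1 + ‖u‖)) ^ m * ‖iteratedFDeriv ℝ (n + 1) f u‖ := by
          gcongr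
          have := norm_le_one_add_mul_one_add_sub t (t - u)
          rw [sub_sub_cancel] at this
          refine this.trans ?_
          gcongr
      _ = (1 + (‖a‖ + ‖b‖)) ^ m * ((1 + ‖u‖) ^ m * ‖iteratedFDeriv ℝ (n + 1) f u‖) := by
          rw [mul_pow, mul_assoc]
      _ ≤ _ := by
          refine mul_le_mul_of_nonneg_left ?_ (by positivity)
          exact SchwartzMap.one_add_le_sup_seminorm_apply (𝕜 := ℂ) (m := (m, n + 1))
            le_rfl le_rfl f _
  have := (convex_segment (t - b) (t - a)).norm_image_sub_le_of_norm_fderiv_le (𝕜 := ℝ)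
    (fun u _ => hd u) hbd (left_mem_segment ℝ _ _) (right_mem_segment ℝ _ _)
  have h2 : ‖t - a - (t - b)‖ = ‖a - b‖ := by rw [← norm_neg]; congr 1; abel
  rw [h2, div_mul_eq_mul_div, le_div_iff₀ h0, mul_comm] at this
  exact this

/-- Joint continuity: the difference splits as a translate of `f - f₀`, bounded polynomially in the
shift, plus a difference of two translates of the fixed `f₀`, which is Lipschitz on bounded sets of
shifts. -/
theorem continuous_compSubConst :
    Continuous fun q : V × 𝓢(V, ℂ) => SchwartzMap.compSubConstCLM ℂ q.1 q.2 := by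
  rw [continuous_iff_continuousAt]
  rintro ⟨x₀, f₀⟩
  refine ((schwartz_withSeminorms ℂ V ℂ).tendsto_nhds _ _).2 ?_
  rintro ⟨m, n⟩ ε hε
  set P := (Finset.Iic (m, n)).sup (schwartzSeminormFamily ℂ V ℂ)
  set Q := (2 ^ m * (Finset.Iic (m, n + 1)).sup (schwartzSeminormFamily ℂ V ℂ) f₀)
  have hP : Continuous fun f : 𝓢(V, ℂ) => P f := continuous_sup_seminorm _
  have hlim : Tendsto (fun q : V × 𝓢(V, ℂ) => (1 + ‖q.1‖) ^ m * (2 ^ m * P (q.2 - f₀)) +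
      (1 + (‖q.1‖ + ‖x₀‖)) ^ m * Q * ‖q.1 - x₀‖) (𝓝 (x₀, f₀)) (𝓝 0) := by
    have hc : Continuous (fun q : V × 𝓢(V, ℂ) => (1 + ‖q.1‖) ^ m * (2 ^ m * P (q.2 - f₀)) +
        (1 + (‖q.1‖ + ‖x₀‖)) ^ m * Q * ‖q.1 - x₀‖) := by
      have : Continuous fun q : V × 𝓢(V, ℂ) => P (q.2 - f₀) :=
        hP.comp (continuous_snd.sub continuous_const)
      fun_prop
    have := hc.tendsto (x₀, f₀)
    simpa using this
  filter_upwards [hlim.eventually (gt_mem_nhds hε)] with q hq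
  refine lt_of_le_of_lt ?_ hq
  have e : SchwartzMap.compSubConstCLM ℂ q.1 q.2 - SchwartzMap.compSubConstCLM ℂ x₀ f₀ =
      SchwartzMap.compSubConstCLM ℂ q.1 (q.2 - f₀) +
      (SchwartzMap.compSubConstCLM ℂ q.1 f₀ - SchwartzMap.compSubConstCLM ℂ x₀ f₀) := by
    rw [map_sub]; abel
  rw [e]
  refine (map_add_le_add _ _ _).trans (add_le_add ?_ ?_)
  · exact seminorm_compSubConst_le m n _ _
  · exact seminorm_compSubConst_sub_le m n f₀ _ _

end Translation

/-- Modulation is translation conjugated by the Fourier transform, so continuity and seminorm bounds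
for modulations follow from those for translations. -/
theorem smulLeft_character_eq {n : ℕ} (f : 𝓢(E n, ℂ)) (ξ : E n) :
    SchwartzMap.smulLeftCLM ℂ (character ξ) f =
      𝓕⁻ (SchwartzMap.compSubConstCLM ℂ ξ (𝓕 f)) := by
  ext t
  rw [SchwartzMap.smulLeftCLM_apply_apply (hasTemperateGrowth_character ξ)]
  rw [SchwartzMap.fourierInv_coe, Real.fourierInv_eq']
  have h : f t = ∫ v, Complex.exp ((↑(2 * Real.pi * inner ℝ v t) * Complex.I)) • (𝓕 f) v := by
    rw [← Real.fourierInv_eq', ← SchwartzMap.fourierInv_coe]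
    simp
  rw [h, smul_eq_mul, ← integral_const_mul]
  rw [← integral_sub_right_eq_self _ ξ]
  refine integral_congr_ae (ae_of_all _ fun v => ?_)
  simp only [character, smul_eq_mul, SchwartzMap.compSubConstCLM_apply]
  rw [← mul_assoc, ← Complex.exp_add]
  congr 2
  rw [inner_sub_left, real_inner_comm t ξ]
  push_cast
  ring

theorem timeFreqShift_eq {n : ℕ} (φ : 𝓢(E n, ℂ)) (x ξ : E n) :
    timeFreqShift φ x ξ =
      𝓕⁻ (SchwartzMap.compSubConstCLM ℂ ξ (𝓕 (SchwartzMap.compSubConstCLM ℂ x φ))) :=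
  smulLeft_character_eq _ _

theorem continuous_timeFreqShift {n : ℕ} (φ : 𝓢(E n, ℂ)) :
    Continuous fun w : E n × E n => timeFreqShift φ w.1 w.2 := by
  simp_rw [timeFreqShift_eq]
  have h1 : Continuous fun w : E n × E n => SchwartzMap.compSubConstCLM ℂ w.1 φ :=
    continuous_compSubConst.comp (continuous_fst.prodMk continuous_const)
  have h2 : Continuous fun w : E n × E n => 𝓕 (SchwartzMap.compSubConstCLM ℂ w.1 φ) :=
    (fourierCLM ℂ 𝓢(E n, ℂ)).continuous.comp h1
  exact (fourierInvCLM ℂ 𝓢(E n, ℂ)).continuous.comp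
    (continuous_compSubConst.comp (continuous_snd.prodMk h2))

/-- A continuous linear endomorphism of Schwartz space is bounded for the seminorms. -/
theorem exists_seminorm_le_of_clm {V : Type*} [NormedAddCommGroup V] [NormedSpace ℝ V]
    (T : 𝓢(V, ℂ) →L[ℂ] 𝓢(V, ℂ)) (s : Finset (ℕ × ℕ)) :
    ∃ (N : ℕ × ℕ) (C : ℝ), 0 ≤ C ∧ ∀ f, s.sup (schwartzSeminormFamily ℂ V ℂ) (T f) ≤
      C * (Finset.Iic N).sup (schwartzSeminormFamily ℂ V ℂ) f := by
  obtain ⟨t, C, -, h⟩ := Seminorm.bound_of_continuous (schwartz_withSeminorms ℂ V ℂ)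
    ((s.sup (schwartzSeminormFamily ℂ V ℂ)).comp T.toLinearMap)
    ((continuous_sup_seminorm s).comp T.continuous)
  refine ⟨t.sup id, C, C.2, fun f => (h f).trans ?_⟩
  have : t.sup (schwartzSeminormFamily ℂ V ℂ) ≤
      (Finset.Iic (t.sup id)).sup (schwartzSeminormFamily ℂ V ℂ) :=
    Finset.sup_mono fun i hi => Finset.mem_Iic.2 (Finset.le_sup (f := id) hi)
  exact mul_le_mul_of_nonneg_left (this f) C.2

theorem sup_seminorm_compSubConst_le {V : Type*} [NormedAddCommGroup V] [NormedSpace ℝ V]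
    (N : ℕ × ℕ) (f : 𝓢(V, ℂ)) (x : V) :
    (Finset.Iic N).sup (schwartzSeminormFamily ℂ V ℂ) (SchwartzMap.compSubConstCLM ℂ x f) ≤
      (1 + ‖x‖) ^ N.1 * (2 ^ N.1 * (Finset.Iic N).sup (schwartzSeminormFamily ℂ V ℂ) f) := by
  refine Seminorm.finset_sup_apply_le (by positivity) fun i hi => ?_
  rw [Finset.mem_Iic] at hi
  refine (seminorm_compSubConst_le i.1 i.2 f x).trans ?_
  have h1 : i.1 ≤ N.1 := hi.1
  have hsup : (Finset.Iic (i.1, i.2)).sup (schwartzSeminormFamily ℂ V ℂ) ≤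
      (Finset.Iic N).sup (schwartzSeminormFamily ℂ V ℂ) :=
    Finset.sup_mono (Finset.Iic_subset_Iic.2 hi)
  have hx : (1 : ℝ) ≤ 1 + ‖x‖ := by linarith [norm_nonneg x]
  gcongr
  · norm_num
  · exact hsup f

/-- Only polynomial growth in `(x, ξ)` matters: it will be absorbed by the rapid decay of
`dualGabor` on Schwartz functions. -/
theorem exists_seminorm_timeFreqShift_le {n : ℕ} (φ : 𝓢(E n, ℂ)) (i : ℕ × ℕ) :
    ∃ (a : ℕ) (C : ℝ), 0 ≤ C ∧ ∀ x ξ : E n, SchwartzMap.seminorm ℂ i.1 i.2 (timeFreqShift φ x ξ) ≤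
      C * ((1 + ‖x‖) ^ a * (1 + ‖ξ‖) ^ a) := by
  obtain ⟨N₁, C₁, hC₁, h₁⟩ := exists_seminorm_le_of_clm (fourierInvCLM ℂ 𝓢(E n, ℂ)) {i}
  obtain ⟨N₂, C₂, hC₂, h₂⟩ := exists_seminorm_le_of_clm (fourierCLM ℂ 𝓢(E n, ℂ)) (Finset.Iic N₁)
  set P := (Finset.Iic N₂).sup (schwartzSeminormFamily ℂ (E n) ℂ) φ
  have hP : 0 ≤ P := apply_nonneg _ _
  refine ⟨N₁.1 + N₂.1, C₁ * (2 ^ N₁.1 * (C₂ * (2 ^ N₂.1 * P))), by positivity, fun x ξ => ?_⟩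
  have hx : (1 : ℝ) ≤ 1 + ‖x‖ := by linarith [norm_nonneg x]
  have hξ : (1 : ℝ) ≤ 1 + ‖ξ‖ := by linarith [norm_nonneg ξ]
  have e1 := h₁ (SchwartzMap.compSubConstCLM ℂ ξ (𝓕 (SchwartzMap.compSubConstCLM ℂ x φ)))
  rw [Finset.sup_singleton] at e1
  have e2 := sup_seminorm_compSubConst_le N₁ (𝓕 (SchwartzMap.compSubConstCLM ℂ x φ)) ξ
  have e3 := h₂ (SchwartzMap.compSubConstCLM ℂ x φ)
  have e4 := sup_seminorm_compSubConst_le N₂ φ x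
  rw [timeFreqShift_eq]
  refine e1.trans ?_
  calc _ ≤ C₁ * ((1 + ‖ξ‖) ^ N₁.1 * (2 ^ N₁.1 * (C₂ * ((1 + ‖x‖) ^ N₂.1 * (2 ^ N₂.1 * P))))) := by
        gcongr
        refine e2.trans ?_
        gcongr
        refine e3.trans ?_
        gcongr
    _ = (C₁ * (2 ^ N₁.1 * (C₂ * (2 ^ N₂.1 * P)))) * ((1 + ‖x‖) ^ N₂.1 * (1 + ‖ξ‖) ^ N₁.1) := by
        ring
    _ ≤ _ := by
        gcongr
        · omega
        · omega

theorem continuous_conjS {n : ℕ} : Continuous (conjS : 𝓢(E n, ℂ) → 𝓢(E n, ℂ)) :=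
  (SchwartzMap.postcompCLM (𝕜 := ℝ) (Complex.conjCLE : ℂ →L[ℝ] ℂ)).continuous

theorem norm_iteratedFDeriv_conjS {n : ℕ} (φ : 𝓢(E n, ℂ)) (i : ℕ) (t : E n) :
    ‖iteratedFDeriv ℝ i (conjS φ) t‖ = ‖iteratedFDeriv ℝ i φ t‖ := by
  have : ⇑(conjS φ) = Complex.conjLIE ∘ φ := by funext t; simp [conjS_apply]
  rw [this]
  exact LinearIsometryEquiv.norm_iteratedFDeriv_comp_left Complex.conjLIE φ t i

theorem seminorm_conjS {n : ℕ} (φ : 𝓢(E n, ℂ)) (m i : ℕ) :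
    SchwartzMap.seminorm ℂ m i (conjS φ) ≤ SchwartzMap.seminorm ℂ m i φ := by
  refine SchwartzMap.seminorm_le_bound ℂ m i _ (apply_nonneg _ _) fun t => ?_
  rw [norm_iteratedFDeriv_conjS]
  exact SchwartzMap.le_seminorm ℂ m i φ t

theorem continuous_gaborTransform {n : ℕ} (φ : 𝓢(E n, ℂ)) (f : 𝓢'(E n, ℂ)) :
    Continuous fun w : E n × E n => gaborTransform φ f w.1 w.2 :=
  (map_continuous f).comp (continuous_conjS.comp (continuous_timeFreqShift φ))

end

end MixedMod

/-! ### Tempered distributions commute with integrals of Schwartz functions -/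

namespace MixedMod

open Filter Topology BoundedContinuousFunction

noncomputable section

variable {V : Type*} [NormedAddCommGroup V] [NormedSpace ℝ V]

/-- The normed space in which `n`-th derivatives take their values. -/
def DerivSpace (V : Type*) [NormedAddCommGroup V] [NormedSpace ℝ V] (n : ℕ) : Type _ :=
  V [×n]→L[ℝ] ℂ

instance (n : ℕ) : NormedAddCommGroup (DerivSpace V n) :=
  inferInstanceAs (NormedAddCommGroup (V [×n]→L[ℝ] ℂ))

instance (n : ℕ) : NormedSpace ℝ (DerivSpace V n) :=
  inferInstanceAs (NormedSpace ℝ (V [×n]→L[ℝ] ℂ))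

instance (n : ℕ) : NormedSpace ℂ (DerivSpace V n) :=
  inferInstanceAs (NormedSpace ℂ (V [×n]→L[ℝ] ℂ))

instance (n : ℕ) : SMulCommClass ℝ ℂ (DerivSpace V n) :=
  inferInstanceAs (SMulCommClass ℝ ℂ (V [×n]→L[ℝ] ℂ))

instance (n : ℕ) : CompleteSpace (DerivSpace V n) :=
  inferInstanceAs (CompleteSpace (V [×n]→L[ℝ] ℂ))

/-- The `n`-th derivative as an element of `DerivSpace V n`. -/
def derivAt (n : ℕ) (f : V → ℂ) (t : V) : DerivSpace V n := iteratedFDeriv ℝ n f t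

theorem norm_derivAt (n : ℕ) (f : V → ℂ) (t : V) : ‖derivAt n f t‖ = ‖iteratedFDeriv ℝ n f t‖ :=
  rfl

theorem continuous_derivAt (n : ℕ) (f : 𝓢(V, ℂ)) : Continuous (derivAt n f) :=
  (f.smooth n).continuous_iteratedFDeriv le_rfl

theorem derivAt_add (n : ℕ) (f g : 𝓢(V, ℂ)) (t : V) :
    derivAt n (f + g : 𝓢(V, ℂ)) t = derivAt n f t + derivAt n g t := by
  rw [FunLike.coe_add]
  exact iteratedFDeriv_add_apply (f.smooth n).contDiffAt (g.smooth n).contDiffAt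

theorem derivAt_smul (n : ℕ) (a : ℂ) (f : 𝓢(V, ℂ)) (t : V) :
    derivAt n (a • f : 𝓢(V, ℂ)) t = a • derivAt n f t := by
  rw [FunLike.coe_smul]
  exact iteratedFDeriv_const_smul_apply (f.smooth n).contDiffAt

/-- Curry the first vector of a derivative. -/
def derivCurry (n : ℕ) : DerivSpace V (n + 1) ≃ₗᵢ[ℝ] (V →L[ℝ] DerivSpace V n) :=
  continuousMultilinearCurryLeftEquiv ℝ (fun _ : Fin (n + 1) => V) ℂ

theorem fderiv_derivAt (n : ℕ) (f : V → ℂ) (t : V) :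
    fderiv ℝ (derivAt n f) t = derivCurry n (derivAt (n + 1) f t) :=
  ((derivCurry n).apply_symm_apply _).symm

theorem differentiable_derivAt (n : ℕ) (f : 𝓢(V, ℂ)) : Differentiable ℝ (derivAt n f) :=
  (f.smooth (n + 1)).differentiable_iteratedFDeriv (by exact_mod_cast Nat.lt_succ_self n)

/-- The value at `t` of the `n`-th derivative, as a continuous linear map on Schwartz space. -/
def derivAtCLM (n : ℕ) (t : V) : 𝓢(V, ℂ) →L[ℂ] DerivSpace V n :=
  SchwartzMap.mkCLMtoNormedSpace (𝕜 := ℂ) (σ := RingHom.id ℂ) (fun f => derivAt n f t)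
    (fun f g => derivAt_add n f g t) (fun a f => derivAt_smul n a f t)
    ⟨{(0, n)}, 1, zero_le_one, fun f => by
      simpa [norm_derivAt] using SchwartzMap.norm_iteratedFDeriv_le_seminorm ℂ f n t⟩

/-- The function `t ↦ ‖t‖ ^ m • f⁽ⁿ⁾(t)`. -/
def weightedDeriv (i : ℕ × ℕ) (f : 𝓢(V, ℂ)) : V →ᵇ DerivSpace V i.2 :=
  BoundedContinuousFunction.ofNormedAddCommGroup
    (fun t => ‖t‖ ^ i.1 • derivAt i.2 f t)
    ((by fun_prop : Continuous fun t : V => ‖t‖ ^ i.1).smul (continuous_derivAt i.2 f))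
    (SchwartzMap.seminorm ℂ i.1 i.2 f)
    (fun t => by
      rw [norm_smul, norm_pow, norm_norm]
      exact SchwartzMap.le_seminorm ℂ i.1 i.2 f t)

theorem weightedDeriv_apply (i : ℕ × ℕ) (f : 𝓢(V, ℂ)) (t : V) :
    weightedDeriv i f t = ‖t‖ ^ i.1 • derivAt i.2 f t := rfl

theorem norm_weightedDeriv (i : ℕ × ℕ) (f : 𝓢(V, ℂ)) :
    ‖weightedDeriv i f‖ = SchwartzMap.seminorm ℂ i.1 i.2 f := by
  refine le_antisymm (BoundedContinuousFunction.norm_ofNormedAddCommGroup_le _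
    (apply_nonneg _ _) _) ?_
  refine SchwartzMap.seminorm_le_bound ℂ i.1 i.2 f (norm_nonneg _) fun t => ?_
  have := (weightedDeriv i f).norm_coe_le_norm t
  rwa [weightedDeriv_apply, norm_smul, norm_pow, norm_norm] at this

/-- The weighted derivatives of a Schwartz function with indices in a finite set. -/
def weightedDerivs (s : Finset (ℕ × ℕ)) :
    𝓢(V, ℂ) →L[ℂ] ((i : s) → V →ᵇ DerivSpace V i.1.2) :=
  SchwartzMap.mkCLMtoNormedSpace (𝕜 := ℂ) (σ := RingHom.id ℂ)
    (fun f (i : s) => weightedDeriv i.1 f)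
    (fun f g => by
      funext i
      ext1 t
      simp only [Pi.add_apply, BoundedContinuousFunction.add_apply, weightedDeriv_apply]
      rw [derivAt_add, smul_add])
    (fun a f => by
      funext i
      ext1 t
      simp only [Pi.smul_apply, BoundedContinuousFunction.smul_apply, weightedDeriv_apply]
      rw [derivAt_smul, smul_comm]; rfl)
    ⟨s, 1, zero_le_one, fun f => by
      rw [one_mul]
      refine (pi_norm_le_iff_of_nonneg (apply_nonneg _ _)).2 fun i => ?_
      rw [norm_weightedDeriv]
      exact Seminorm.le_finset_sup_apply (p := schwartzSeminormFamily ℂ V ℂ) i.2⟩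

theorem weightedDerivs_apply (s : Finset (ℕ × ℕ)) (f : 𝓢(V, ℂ)) (i : s) :
    weightedDerivs s f i = weightedDeriv i.1 f := rfl

/-- Continuity of `k` means a bound by finitely many seminorms, which are sup norms of weighted
derivatives. Thus `k` is a bounded functional on a subspace of a Banach space, and Hahn–Banach
extends it. Bochner integration then becomes available. -/
theorem exists_factor_weightedDerivs (k : 𝓢(V, ℂ) →L[ℂ] ℂ) :
    ∃ (s : Finset (ℕ × ℕ)) (l : ((i : s) → V →ᵇ DerivSpace V i.1.2) →L[ℂ] ℂ),
      ∀ f, k f = l (weightedDerivs s f) := by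
  obtain ⟨t, C, -, h⟩ := Seminorm.bound_of_continuous (schwartz_withSeminorms ℂ V ℂ)
    ((normSeminorm ℂ ℂ).comp k.toLinearMap) (continuous_norm.comp k.continuous)
  -- The index `(0, 0)` records `f` itself and makes the embedding injective.
  set s := insert (0, 0) t
  have hinj : Function.Injective (weightedDerivs (V := V) s) := by
    intro f g hfg
    ext x
    have h1 := congrFun hfg ⟨(0, 0), Finset.mem_insert_self _ _⟩
    have h2 := DFunLike.congr_fun h1 x
    change ‖x‖ ^ 0 • derivAt 0 f x = ‖x‖ ^ 0 • derivAt 0 g x at h2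
    rw [pow_zero, one_smul, one_smul] at h2
    have h3 : iteratedFDeriv ℝ 0 f x = iteratedFDeriv ℝ 0 g x := h2
    simpa using DFunLike.congr_fun h3 (fun _ => 0)
  let e := LinearEquiv.ofInjective (weightedDerivs (V := V) s).toLinearMap hinj
  have hbd : ∀ y, ‖(k.toLinearMap ∘ₗ e.symm.toLinearMap) y‖ ≤ C * ‖y‖ := by
    intro y
    obtain ⟨f, rfl⟩ := e.surjective y
    have h1 : ‖k f‖ ≤ C * t.sup (schwartzSeminormFamily ℂ V ℂ) f := h f
    simp only [LinearMap.comp_apply, LinearEquiv.coe_coe, LinearEquiv.symm_apply_apply]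
    refine h1.trans (mul_le_mul_of_nonneg_left ?_ C.2)
    refine Seminorm.finset_sup_apply_le (norm_nonneg _) fun i hi => ?_
    have h2 : ‖weightedDerivs s f ⟨i, Finset.mem_insert_of_mem hi⟩‖ ≤ ‖weightedDerivs s f‖ :=
      norm_le_pi_norm (weightedDerivs s f) _
    rw [weightedDerivs_apply, norm_weightedDeriv] at h2
    exact h2
  obtain ⟨l, hl, -⟩ := exists_extension_norm_eq _
    ((k.toLinearMap ∘ₗ e.symm.toLinearMap).mkContinuous C hbd)
  refine ⟨s, l, fun f => ?_⟩
  have := hl (e f)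
  simp only [LinearMap.mkContinuous_apply, LinearMap.comp_apply, LinearEquiv.coe_coe,
    LinearEquiv.symm_apply_apply] at this
  exact this.symm

variable {W : Type*} [TopologicalSpace W] [SecondCountableTopology W] [MeasurableSpace W]
  [OpensMeasurableSpace W] {μ : Measure W} {Φ : W → 𝓢(V, ℂ)}

theorem integrable_derivAt (hΦ : Continuous Φ) (n : ℕ)
    (hint : Integrable (fun w => SchwartzMap.seminorm ℂ 0 n (Φ w)) μ) (t : V) :
    Integrable (fun w => derivAt n (Φ w) t) μ :=
  hint.mono' ((derivAtCLM n t).continuous.comp hΦ).aestronglyMeasurable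
    (ae_of_all _ fun w => SchwartzMap.norm_iteratedFDeriv_le_seminorm ℂ (Φ w) n t)

/-- Differentiation under the integral sign, one order at a time; the seminorm with indices `(0, n +
1)` dominates uniformly in `t`. -/
theorem derivAt_eq_integral (hΦ : Continuous Φ)
    (hint : ∀ n : ℕ, Integrable (fun w => SchwartzMap.seminorm ℂ 0 n (Φ w)) μ)
    (ψ : V → ℂ) (hψ : ∀ t, ψ t = ∫ w, Φ w t ∂μ) (n : ℕ) (t : V) :
    derivAt n ψ t = ∫ w, derivAt n (Φ w) t ∂μ := by
  induction n generalizing t with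
  | zero =>
    let L : ℂ ≃ₗᵢ[ℝ] DerivSpace V 0 := (continuousMultilinearCurryFin0 ℝ V ℂ).symm
    have hL : ∀ f : V → ℂ, derivAt 0 f t = L (f t) := fun f => rfl
    simp_rw [hL, hψ]
    exact (L.toContinuousLinearEquiv.integral_comp_comm _).symm
  | succ n ih =>
    have hd : HasFDerivAt (fun t => ∫ w, derivAt n (Φ w) t ∂μ)
        (∫ w, fderiv ℝ (derivAt n (Φ w)) t ∂μ) t := by
      refine hasFDerivAt_integral_of_dominated_of_fderiv_le (Metric.ball_mem_nhds t one_pos)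
        (bound := fun w => SchwartzMap.seminorm ℂ 0 (n + 1) (Φ w))
        (F' := fun s w => fderiv ℝ (derivAt n (Φ w)) s)
        (Eventually.of_forall fun s => (integrable_derivAt hΦ n (hint n) s).1)
        (integrable_derivAt hΦ n (hint n) t) ?_ ?_ (hint (n + 1)) ?_
      · simp_rw [fderiv_derivAt]
        exact (derivCurry n).continuous.comp_aestronglyMeasurable
          (integrable_derivAt hΦ (n + 1) (hint (n + 1)) t).1
      · refine ae_of_all _ fun w s _ => ?_
        rw [fderiv_derivAt, LinearIsometryEquiv.norm_map]
        exact SchwartzMap.norm_iteratedFDeriv_le_seminorm ℂ (Φ w) (n + 1) s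
      · exact ae_of_all _ fun w s _ => (differentiable_derivAt n (Φ w) s).hasFDerivAt
    refine (derivCurry n).injective ?_
    rw [← fderiv_derivAt, funext ih, hd.fderiv]
    simp_rw [fderiv_derivAt]
    exact (derivCurry n).toContinuousLinearEquiv.integral_comp_comm _

/-- After factoring `k` through a Banach space the claim is that a bounded functional commutes with
a Bochner integral. The integral is identified with the image of `ψ` by evaluating each weighted
derivative at each point. -/
theorem clm_apply_eq_integral (k : 𝓢(V, ℂ) →L[ℂ] ℂ) (hΦ : Continuous Φ)
    (hint : ∀ i : ℕ × ℕ, Integrable (fun w => SchwartzMap.seminorm ℂ i.1 i.2 (Φ w)) μ)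
    (ψ : 𝓢(V, ℂ)) (hψ : ∀ t, ψ t = ∫ w, Φ w t ∂μ) :
    k ψ = ∫ w, k (Φ w) ∂μ := by
  obtain ⟨s, l, hl⟩ := exists_factor_weightedDerivs k
  simp_rw [hl]
  have hmeas : AEStronglyMeasurable (fun w => weightedDerivs s (Φ w)) μ :=
    ((weightedDerivs s).continuous.comp hΦ).aestronglyMeasurable
  have hi : Integrable (fun w => weightedDerivs s (Φ w)) μ := by
    refine (integrable_finsetSum s fun i _ => hint i).mono' hmeas (ae_of_all _ fun w => ?_)
    refine (pi_norm_le_iff_of_nonneg (Finset.sum_nonneg fun i _ => apply_nonneg _ _)).2 fun i => ?_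
    rw [weightedDerivs_apply, norm_weightedDeriv]
    exact Finset.single_le_sum (f := fun i : ℕ × ℕ => SchwartzMap.seminorm ℂ i.1 i.2 (Φ w))
      (fun i _ => apply_nonneg _ _) i.2
  rw [l.integral_comp_comm hi]
  congr 1
  funext i
  ext1 t
  let ev : ((i : s) → V →ᵇ DerivSpace V i.1.2) →L[ℝ] DerivSpace V i.1.2 :=
    (BoundedContinuousFunction.evalCLM ℝ t).comp (ContinuousLinearMap.proj i)
  have hev : ∀ F, ev F = F i t := fun F => rfl
  rw [← hev (∫ w, weightedDerivs s (Φ w) ∂μ), ← ev.integral_comp_comm hi]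
  simp_rw [hev, weightedDerivs_apply, weightedDeriv_apply]
  rw [integral_smul]
  congr 1
  exact derivAt_eq_integral hΦ (fun n => hint (0, n)) ψ hψ _ t

end

end MixedMod

/-! ### The inversion formula for the Gabor transform of a tempered distribution -/

namespace MixedMod

open Filter Topology FourierTransform

noncomputable section

/-- The transform `h ↦ ∫ h(t) γ(t - x) exp(2πi t·ξ) dt`, dual to the Gabor transform. -/
def dualGabor {n : ℕ} (γ : 𝓢(E n, ℂ)) (h : E n → ℂ) (w : E n × E n) : ℂ :=
  ∫ t, h t * timeFreqShift γ w.1 w.2 t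

/-- The Schwartz function `t ↦ ψ(t) γ(t - x)`. -/
def mulTranslate {n : ℕ} (ψ γ : 𝓢(E n, ℂ)) (x : E n) : 𝓢(E n, ℂ) :=
  SchwartzMap.smulLeftCLM ℂ ψ (SchwartzMap.compSubConstCLM ℂ x γ)

theorem mulTranslate_apply {n : ℕ} (ψ γ : 𝓢(E n, ℂ)) (x t : E n) :
    mulTranslate ψ γ x t = ψ t * γ (t - x) := by
  simp [mulTranslate, ψ.hasTemperateGrowth]

theorem continuous_mulTranslate {n : ℕ} (ψ γ : 𝓢(E n, ℂ)) : Continuous (mulTranslate ψ γ) :=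
  (SchwartzMap.smulLeftCLM ℂ ψ).continuous.comp
    (continuous_compSubConst.comp (continuous_id.prodMk continuous_const))

theorem dualGabor_eq_fourierInv {n : ℕ} (γ ψ : 𝓢(E n, ℂ)) (x ξ : E n) :
    dualGabor γ ψ (x, ξ) = 𝓕⁻ (mulTranslate ψ γ x) ξ := by
  rw [SchwartzMap.fourierInv_coe, Real.fourierInv_eq', dualGabor]
  refine integral_congr_ae (ae_of_all _ fun t => ?_)
  simp only [timeFreqShift_apply, mulTranslate_apply, smul_eq_mul]
  have : (2 * Real.pi * Complex.I * ((inner ℝ t ξ : ℝ) : ℂ)) =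
    ↑(2 * Real.pi * inner ℝ t ξ) * Complex.I := by push_cast; ring
  rw [this]
  ring

theorem continuous_dualGabor_schwartz {n : ℕ} (γ ψ : 𝓢(E n, ℂ)) : Continuous (dualGabor γ ψ) := by
  have h1 : Continuous fun w : E n × E n =>
      (SchwartzMap.toBoundedContinuousFunctionCLM ℂ (E n) ℂ)
        ((fourierInvCLM ℂ 𝓢(E n, ℂ)) (mulTranslate ψ γ w.1)) := by
    have := (continuous_mulTranslate ψ γ).comp (continuous_fst (X := E n) (Y := E n))
    exact (ContinuousLinearMap.continuous _).comp ((ContinuousLinearMap.continuous _).comp this)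
  have h2 := h1.eval (continuous_snd (X := E n) (Y := E n))
  convert h2 using 1
  funext w
  exact dualGabor_eq_fourierInv γ ψ w.1 w.2

/-- A point cannot be close to both `0` and `x` when `x` is large: `1 + ‖x‖ ≤ (1 + ‖t‖)(1 + ‖t -
x‖)`. The decay of the two factors in the Leibniz expansion therefore pays for any power of `1 +
‖x‖`. -/
theorem exists_sup_seminorm_mulTranslate_le {n : ℕ} (ψ γ : 𝓢(E n, ℂ)) (N : ℕ × ℕ) (b : ℕ) :
    ∃ C : ℝ, 0 ≤ C ∧ ∀ x, (1 + ‖x‖) ^ b *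
      (Finset.Iic N).sup (schwartzSeminormFamily ℂ (E n) ℂ) (mulTranslate ψ γ x) ≤ C := by
  -- Of the `N.1 + b` powers taken from `ψ`, `N.1` absorb the Schwartz weight and `b` serve, with
  -- the `b` powers from `γ`, to absorb `(1 + ‖x‖) ^ b`.
  set P := 2 ^ (N.1 + b) *
    (Finset.Iic (N.1 + b, N.2)).sup (schwartzSeminormFamily ℂ (E n) ℂ) ψ with hP
  set Q := 2 ^ b * (Finset.Iic (b, N.2)).sup (schwartzSeminormFamily ℂ (E n) ℂ) γ with hQ
  have hP0 : 0 ≤ P := by positivity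
  have hQ0 : 0 ≤ Q := by positivity
  refine ⟨2 ^ N.2 * (P * Q), by positivity, fun x => ?_⟩
  have hx : 0 < (1 + ‖x‖) ^ b := by positivity
  rw [mul_comm, ← le_div_iff₀ hx]
  refine Seminorm.finset_sup_apply_le (by positivity) fun i hi => ?_
  rw [Finset.mem_Iic] at hi
  have hi1 : i.1 ≤ N.1 := hi.1
  have hi2 : i.2 ≤ N.2 := hi.2
  refine SchwartzMap.seminorm_le_bound ℂ i.1 i.2 _ (by positivity) fun t => ?_
  rw [le_div_iff₀ hx]
  have e : ⇑(mulTranslate ψ γ x) = fun t => ψ t * (SchwartzMap.compSubConstCLM ℂ x γ) t := by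
    funext t; simp [mulTranslate_apply]
  have hprod := norm_iteratedFDeriv_mul_le (ψ.smooth i.2)
    ((SchwartzMap.compSubConstCLM ℂ x γ).smooth i.2) t (n := i.2) le_rfl
  rw [← e] at hprod
  have hxt : 1 + ‖x‖ ≤ (1 + ‖t‖) * (1 + ‖t - x‖) := by
    have : ‖x‖ ≤ ‖t‖ + ‖t - x‖ := by
      calc ‖x‖ = ‖t - (t - x)‖ := by congr 1; abel
        _ ≤ _ := norm_sub_le _ _
    nlinarith [norm_nonneg t, norm_nonneg (t - x), mul_nonneg (norm_nonneg t) (norm_nonneg (t - x))]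
  have hterm : ∀ j ∈ Finset.range (i.2 + 1),
      ‖t‖ ^ i.1 * (1 + ‖x‖) ^ b * (‖iteratedFDeriv ℝ j ψ t‖ *
        ‖iteratedFDeriv ℝ (i.2 - j) (SchwartzMap.compSubConstCLM ℂ x γ) t‖) ≤ P * Q := by
    intro j hj
    have hj' : j ≤ i.2 := Nat.lt_succ_iff.1 (Finset.mem_range.1 hj)
    rw [iteratedFDeriv_compSubConst]
    have h1 : (1 + ‖t‖) ^ (N.1 + b) * ‖iteratedFDeriv ℝ j ψ t‖ ≤ P :=
      SchwartzMap.one_add_le_sup_seminorm_apply (𝕜 := ℂ) (m := (N.1 + b, N.2)) le_rfl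
        (hj'.trans hi2) ψ t
    have h2 : (1 + ‖t - x‖) ^ b * ‖iteratedFDeriv ℝ (i.2 - j) γ (t - x)‖ ≤ Q :=
      SchwartzMap.one_add_le_sup_seminorm_apply (𝕜 := ℂ) (m := (b, N.2)) le_rfl
        ((Nat.sub_le _ _).trans hi2) γ (t - x)
    have h3 : ‖t‖ ^ i.1 ≤ (1 + ‖t‖) ^ N.1 :=
      (pow_le_pow_left₀ (norm_nonneg t) (by linarith) _).trans
        (pow_le_pow_right₀ (by linarith [norm_nonneg t]) hi1)
    calc _ ≤ (1 + ‖t‖) ^ N.1 * ((1 + ‖t‖) * (1 + ‖t - x‖)) ^ b * (‖iteratedFDeriv ℝ j ψ t‖ *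
            ‖iteratedFDeriv ℝ (i.2 - j) γ (t - x)‖) := by gcongr
      _ = ((1 + ‖t‖) ^ (N.1 + b) * ‖iteratedFDeriv ℝ j ψ t‖) *
            ((1 + ‖t - x‖) ^ b * ‖iteratedFDeriv ℝ (i.2 - j) γ (t - x)‖) := by
          rw [mul_pow, pow_add]; ring
      _ ≤ P * Q := by gcongr
  calc ‖t‖ ^ i.1 * ‖iteratedFDeriv ℝ i.2 (mulTranslate ψ γ x) t‖ * (1 + ‖x‖) ^ b
      ≤ ‖t‖ ^ i.1 * (∑ j ∈ Finset.range (i.2 + 1), (i.2.choose j : ℝ) *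
          ‖iteratedFDeriv ℝ j ψ t‖ *
          ‖iteratedFDeriv ℝ (i.2 - j) (SchwartzMap.compSubConstCLM ℂ x γ) t‖) * (1 + ‖x‖) ^ b := by
        gcongr
    _ = ∑ j ∈ Finset.range (i.2 + 1), (i.2.choose j : ℝ) * (‖t‖ ^ i.1 * (1 + ‖x‖) ^ b *
          (‖iteratedFDeriv ℝ j ψ t‖ *
          ‖iteratedFDeriv ℝ (i.2 - j) (SchwartzMap.compSubConstCLM ℂ x γ) t‖)) := by
        rw [Finset.mul_sum, Finset.sum_mul]
        refine Finset.sum_congr rfl fun j _ => by ring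
    _ ≤ ∑ j ∈ Finset.range (i.2 + 1), (i.2.choose j : ℝ) * (P * Q) :=
        Finset.sum_le_sum fun j hj => mul_le_mul_of_nonneg_left (hterm j hj) (by positivity)
    _ = 2 ^ i.2 * (P * Q) := by
        rw [← Finset.sum_mul]
        congr 1
        exact_mod_cast Nat.sum_range_choose i.2
    _ ≤ 2 ^ N.2 * (P * Q) := by
        gcongr
        norm_num

/-- Decay in `ξ` comes from a Schwartz seminorm of the inverse Fourier transform for fixed `x`;
decay in `x` comes from the smallness of the product `ψ(t) γ(t - x)`. -/
theorem exists_dualGabor_decay {n : ℕ} (γ ψ : 𝓢(E n, ℂ)) (a : ℕ) :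
    ∃ C : ℝ, 0 ≤ C ∧ ∀ w : E n × E n,
      ‖dualGabor γ ψ w‖ * ((1 + ‖w.1‖) ^ a * (1 + ‖w.2‖) ^ a) ≤ C := by
  obtain ⟨N, C₁, hC₁, h₁⟩ :=
    exists_seminorm_le_of_clm (fourierInvCLM ℂ 𝓢(E n, ℂ)) (Finset.Iic (a, 0))
  obtain ⟨C₂, hC₂, h₂⟩ := exists_sup_seminorm_mulTranslate_le ψ γ N a
  refine ⟨2 ^ a * (C₁ * C₂), by positivity, fun w => ?_⟩
  have e1 : (1 + ‖w.2‖) ^ a * ‖iteratedFDeriv ℝ 0 (𝓕⁻ (mulTranslate ψ γ w.1) : 𝓢(E n, ℂ)) w.2‖ ≤ _ :=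
    SchwartzMap.one_add_le_sup_seminorm_apply (𝕜 := ℂ) (m := (a, 0)) le_rfl le_rfl
      (𝓕⁻ (mulTranslate ψ γ w.1)) w.2
  rw [norm_iteratedFDeriv_zero] at e1
  have e2 : dualGabor γ ψ w = 𝓕⁻ (mulTranslate ψ γ w.1) w.2 := dualGabor_eq_fourierInv γ ψ w.1 w.2
  rw [e2]
  have e3 := h₁ (mulTranslate ψ γ w.1)
  have e4 := h₂ w.1
  calc _ = (1 + ‖w.1‖) ^ a * ((1 + ‖w.2‖) ^ a * ‖𝓕⁻ (mulTranslate ψ γ w.1) w.2‖) := by ring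
    _ ≤ (1 + ‖w.1‖) ^ a * (2 ^ a * (C₁ *
        (Finset.Iic N).sup (schwartzSeminormFamily ℂ (E n) ℂ) (mulTranslate ψ γ w.1))) := by
        refine mul_le_mul_of_nonneg_left (e1.trans ?_) (by positivity)
        exact mul_le_mul_of_nonneg_left e3 (by positivity)
    _ = 2 ^ a * (C₁ * ((1 + ‖w.1‖) ^ a *
        (Finset.Iic N).sup (schwartzSeminormFamily ℂ (E n) ℂ) (mulTranslate ψ γ w.1))) := by ring
    _ ≤ _ := by gcongr

/-- Each factor has dimension `n`, so the exponent `n + 1` suffices in each. -/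
theorem integrable_of_polynomial_decay {n : ℕ} {F : E n × E n → ℝ} (hF : Continuous F)
    {C : ℝ} (h : ∀ w, |F w| * ((1 + ‖w.1‖) ^ (n + 1) * (1 + ‖w.2‖) ^ (n + 1)) ≤ C) :
    Integrable F := by
  have h1 : Integrable (fun x : E n => (1 + ‖x‖) ^ (-((n + 1 : ℕ) : ℝ))) := by
    refine integrable_one_add_norm ?_
    simp
  have h2 := (h1.mul_prod h1).const_mul C
  refine h2.mono' hF.aestronglyMeasurable (ae_of_all _ fun w => ?_)
  have a1 : 0 < (1 + ‖w.1‖) ^ (n + 1) := by positivity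
  have a2 : 0 < (1 + ‖w.2‖) ^ (n + 1) := by positivity
  rw [Real.rpow_neg (by positivity), Real.rpow_neg (by positivity), Real.rpow_natCast,
    Real.rpow_natCast, ← mul_inv, ← div_eq_mul_inv, le_div_iff₀ (by positivity), Real.norm_eq_abs]
  exact h w

/-- The inversion formula, tested against a Schwartz function. -/
theorem integral_gaborTransform_mul_dualGabor {n : ℕ} (φ γ : 𝓢(E n, ℂ)) (k : 𝓢'(E n, ℂ))
    (ψ : 𝓢(E n, ℂ)) :
    ∫ w : E n × E n, gaborTransform φ k w.1 w.2 * dualGabor γ ψ w =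
      (∫ t, γ t * (starRingEnd ℂ) (φ t)) * k ψ := by
  set Φ : E n × E n → 𝓢(E n, ℂ) := fun w => dualGabor γ ψ w • conjS (timeFreqShift φ w.1 w.2)
    with hΦdef
  have hcs : Continuous fun w : E n × E n => conjS (timeFreqShift φ w.1 w.2) :=
    continuous_conjS.comp (continuous_timeFreqShift φ)
  have hΦ : Continuous Φ := (continuous_dualGabor_schwartz γ ψ).smul hcs
  have hint : ∀ i : ℕ × ℕ, Integrable (fun w => SchwartzMap.seminorm ℂ i.1 i.2 (Φ w)) := by
    intro i
    obtain ⟨a, C₁, hC₁, h₁⟩ := exists_seminorm_timeFreqShift_le φ i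
    -- Order `a` cancels the growth of the time-frequency shifts, and the remaining `n + 1` gives
    -- integrability.
    obtain ⟨C₂, hC₂, h₂⟩ := exists_dualGabor_decay γ ψ (a + (n + 1))
    refine integrable_of_polynomial_decay (C := C₁ * C₂)
      (((schwartz_withSeminorms ℂ (E n) ℂ).continuous_seminorm i).comp hΦ) fun w => ?_
    rw [abs_of_nonneg (apply_nonneg _ _), hΦdef]
    simp only
    rw [map_smul_eq_mul]
    calc _ ≤ ‖dualGabor γ ψ w‖ * (C₁ * ((1 + ‖w.1‖) ^ a * (1 + ‖w.2‖) ^ a)) *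
          ((1 + ‖w.1‖) ^ (n + 1) * (1 + ‖w.2‖) ^ (n + 1)) := by
          gcongr
          exact (seminorm_conjS _ _ _).trans (h₁ w.1 w.2)
      _ = C₁ * (‖dualGabor γ ψ w‖ *
          ((1 + ‖w.1‖) ^ (a + (n + 1)) * (1 + ‖w.2‖) ^ (a + (n + 1)))) := by
          rw [pow_add, pow_add]; ring
      _ ≤ _ := by gcongr; exact h₂ w
  set c := ∫ t, γ t * (starRingEnd ℂ) (φ t) with hc
  -- Pointwise reconstruction of `c • ψ` as a superposition of conjugated shifts of `φ`; applying
  -- `k` under the integral then gives the formula.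
  have hval : ∀ t, (c • ψ) t = ∫ w, Φ w t := by
    intro t
    have hi : Integrable (fun w => Φ w t) := by
      refine (hint (0, 0)).mono' ?_ (ae_of_all _ fun w => SchwartzMap.norm_le_seminorm ℂ _ t)
      have : Continuous fun w => (SchwartzMap.toBoundedContinuousFunctionCLM ℂ (E n) ℂ) (Φ w) :=
        (ContinuousLinearMap.continuous _).comp hΦ
      exact (this.eval (continuous_const (y := t))).aestronglyMeasurable
    rw [Measure.volume_eq_prod] at hi ⊢
    rw [integral_prod _ hi]
    -- The integral over `ξ` is Fourier inversion for `ψ(t) γ(t - x)`; the later integral over `x`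
    -- produces the constant `c`.
    have hinner : ∀ x, ∫ ξ, Φ (x, ξ) t = ψ t * (γ (t - x) * (starRingEnd ℂ) (φ (t - x))) := by
      intro x
      have e1 : mulTranslate ψ γ x t = ∫ ξ, Complex.exp (↑(-2 * Real.pi * inner ℝ ξ t) * Complex.I) •
          (𝓕⁻ (mulTranslate ψ γ x)) ξ := by
        rw [← Real.fourier_eq', ← SchwartzMap.fourier_coe]
        simp
      rw [mulTranslate_apply] at e1
      rw [← mul_assoc, e1, ← integral_mul_const]
      refine integral_congr_ae (ae_of_all _ fun ξ => ?_)
      simp only [hΦdef, dualGabor_eq_fourierInv, smul_apply, conjS_apply,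
        timeFreqShift_apply, smul_eq_mul, map_mul, ← Complex.exp_conj]
      rw [real_inner_comm t ξ]
      have : (2 * (Real.pi : ℂ) * -Complex.I * ((inner ℝ t ξ : ℝ) : ℂ)) =
          ↑(-2 * Real.pi * inner ℝ t ξ) * Complex.I := by
        push_cast; ring
      simp only [Complex.conj_ofReal, map_ofNat, Complex.conj_I]
      rw [this]
      ring
    simp_rw [hinner]
    rw [integral_const_mul, integral_sub_left_eq_self (fun s => γ s * (starRingEnd ℂ) (φ s)) volume t,
      ← hc, smul_apply, smul_eq_mul, mul_comm]
  have hmain := clm_apply_eq_integral (μ := volume)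
    (⟨k.toLinearMap, map_continuous k⟩ : 𝓢(E n, ℂ) →L[ℂ] ℂ) hΦ hint (c • ψ) hval
  have hmain' : k (c • ψ) = ∫ w, k (Φ w) := hmain
  rw [map_smul, smul_eq_mul] at hmain'
  rw [hmain']
  refine integral_congr_ae (ae_of_all _ fun w => ?_)
  simp only [hΦdef, map_smul, smul_eq_mul, gaborTransform]
  ring

end

end MixedMod

/-! ### The dual Gabor transform on `L²` -/

namespace MixedMod

open Filter Topology FourierTransform

noncomputable section

theorem eLpNorm_two_sq {α F : Type*} [MeasurableSpace α] [NormedAddCommGroup F] (f : α → F)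
    (μ : Measure α) : eLpNorm f 2 μ ^ 2 = ∫⁻ x, ‖f x‖ₑ ^ 2 ∂μ := by
  have := eLpNorm_nnreal_pow_eq_lintegral (f := f) (μ := μ) (p := 2) (by norm_num)
  simpa using this

theorem enorm_L2_sq {α F : Type*} [MeasurableSpace α] [NormedAddCommGroup F] {μ : Measure α}
    (f : Lp F 2 μ) : ‖f‖ₑ ^ 2 = ∫⁻ x, ‖f x‖ₑ ^ 2 ∂μ := by
  rw [Lp.enorm_def, eLpNorm_two_sq]

variable {n : ℕ}

/-- The complex conjugate of a time-frequency shift of `γ`, as an element of `L²`. -/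
def shiftL2 (γ : 𝓢(E n, ℂ)) (w : E n × E n) : L2 n :=
  (conjS (timeFreqShift γ w.1 w.2)).toLp 2

theorem continuous_shiftL2 (γ : 𝓢(E n, ℂ)) : Continuous (shiftL2 γ) :=
  SchwartzMap.continuous_toLp.comp (continuous_conjS.comp (continuous_timeFreqShift γ))

theorem enorm_timeFreqShift_apply (γ : 𝓢(E n, ℂ)) (x ξ t : E n) :
    ‖timeFreqShift γ x ξ t‖ₑ = ‖γ (t - x)‖ₑ := by
  rw [timeFreqShift_apply, enorm_mul]
  have : ‖Complex.exp (2 * Real.pi * Complex.I * ((inner ℝ t ξ : ℝ) : ℂ))‖ₑ = 1 := by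
    rw [enorm_eq_nnnorm, ENNReal.coe_eq_one, ← NNReal.coe_inj]
    simp [Complex.norm_exp]
  rw [this, one_mul]

theorem enorm_conj (z : ℂ) : ‖(starRingEnd ℂ) z‖ₑ = ‖z‖ₑ := by
  simp [enorm_eq_nnnorm]

theorem norm_shiftL2 (γ : 𝓢(E n, ℂ)) (w : E n × E n) : ‖shiftL2 γ w‖ = ‖γ.toLp 2‖ := by
  rw [shiftL2, SchwartzMap.norm_toLp, SchwartzMap.norm_toLp]
  congr 1
  have h1 : eLpNorm (conjS (timeFreqShift γ w.1 w.2)) 2 volume =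
      eLpNorm (γ ∘ fun t => t - w.1) 2 volume := by
    refine eLpNorm_congr_enorm_ae (ae_of_all _ fun t => ?_)
    rw [conjS_apply, enorm_conj, enorm_timeFreqShift_apply]
    rfl
  rw [h1, eLpNorm_comp_measurePreserving γ.continuous.aestronglyMeasurable
    (measurePreserving_sub_right volume w.1)]

/-- This makes `dualGabor` at a point a bounded linear functional of `h`, the source of its
linearity, its continuity in `w` and the Bessel bound. -/
theorem dualGabor_eq_inner (γ : 𝓢(E n, ℂ)) (h : L2 n) (w : E n × E n) :
    dualGabor γ h w = inner ℂ (shiftL2 γ w) h := by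
  rw [L2.inner_def, dualGabor]
  refine integral_congr_ae ?_
  filter_upwards [(conjS (timeFreqShift γ w.1 w.2)).coeFn_toLp 2 volume] with t ht
  rw [shiftL2, ht, conjS_apply]
  simp

theorem dualGabor_congr (γ : 𝓢(E n, ℂ)) {h h' : E n → ℂ} (hh : h =ᵐ[volume] h') (w : E n × E n) :
    dualGabor γ h w = dualGabor γ h' w := by
  refine integral_congr_ae ?_
  filter_upwards [hh] with t ht
  rw [ht]

theorem continuous_dualGabor (γ : 𝓢(E n, ℂ)) (h : L2 n) : Continuous (dualGabor γ h) := by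
  have : dualGabor γ h = fun w => inner ℂ (shiftL2 γ w) h := funext (dualGabor_eq_inner γ h)
  rw [this]
  exact (continuous_shiftL2 γ).inner continuous_const

theorem lintegral_enorm_fourierInv_sq (f : 𝓢(E n, ℂ)) :
    ∫⁻ ξ, ‖𝓕⁻ f ξ‖ₑ ^ 2 = ∫⁻ t, ‖f t‖ₑ ^ 2 := by
  have e : 𝓕 (𝓕⁻ f) = f := by simp
  have h := SchwartzMap.norm_fourier_toL2_eq (𝓕⁻ f)
  rw [e, SchwartzMap.norm_toLp, SchwartzMap.norm_toLp] at h
  have h1 : eLpNorm f 2 volume ≠ ∞ := (f.memLp 2 volume).2.ne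
  have h2 : eLpNorm (𝓕⁻ f : 𝓢(E n, ℂ)) 2 volume ≠ ∞ := ((𝓕⁻ f).memLp 2 volume).2.ne
  have h' : eLpNorm f 2 volume = eLpNorm (𝓕⁻ f : 𝓢(E n, ℂ)) 2 volume := by
    rw [← ENNReal.ofReal_toReal h1, h, ENNReal.ofReal_toReal h2]
  rw [← eLpNorm_two_sq, ← eLpNorm_two_sq, h']

/-- Plancherel in `ξ` for fixed `x`, then Tonelli and translation invariance. -/
theorem lintegral_enorm_dualGabor_sq_schwartz (γ ψ : 𝓢(E n, ℂ)) :
    ∫⁻ w, ‖dualGabor γ ψ w‖ₑ ^ 2 = (∫⁻ t, ‖ψ t‖ₑ ^ 2) * ∫⁻ t, ‖γ t‖ₑ ^ 2 := by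
  rw [Measure.volume_eq_prod, lintegral_prod _ (by
    have := continuous_dualGabor_schwartz γ ψ
    fun_prop)]
  have h1 : ∀ x : E n, ∫⁻ ξ, ‖dualGabor γ ψ (x, ξ)‖ₑ ^ 2 = ∫⁻ t, ‖ψ t‖ₑ ^ 2 * ‖γ (t - x)‖ₑ ^ 2 := by
    intro x
    simp_rw [dualGabor_eq_fourierInv]
    rw [lintegral_enorm_fourierInv_sq]
    refine lintegral_congr fun t => ?_
    rw [mulTranslate_apply, enorm_mul, mul_pow]
  simp_rw [h1]
  have hψ : Measurable fun t => ‖ψ t‖ₑ ^ 2 := ψ.continuous.measurable.enorm.pow_const 2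
  have hγ : Measurable fun t => ‖γ t‖ₑ ^ 2 := γ.continuous.measurable.enorm.pow_const 2
  rw [lintegral_lintegral_swap
    ((hψ.comp measurable_snd).mul (hγ.comp (measurable_snd.sub measurable_fst))).aemeasurable]
  have h2 : ∀ t : E n, ∫⁻ x, ‖ψ t‖ₑ ^ 2 * ‖γ (t - x)‖ₑ ^ 2 =
      ‖ψ t‖ₑ ^ 2 * ∫⁻ t, ‖γ t‖ₑ ^ 2 := by
    intro t
    have : Measurable fun x => ‖γ (t - x)‖ₑ ^ 2 := hγ.comp (measurable_id.const_sub t)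
    rw [lintegral_const_mul _ this,
      lintegral_sub_left_eq_self (fun s => ‖γ s‖ₑ ^ 2) t]
  simp_rw [h2]
  rw [lintegral_mul_const _ hψ]

theorem enorm_toLp_two_sq (γ : 𝓢(E n, ℂ)) : ‖γ.toLp 2‖ₑ ^ 2 = ∫⁻ t, ‖γ t‖ₑ ^ 2 := by
  rw [enorm_L2_sq]
  refine lintegral_congr_ae ?_
  filter_upwards [γ.coeFn_toLp 2 volume] with t ht
  rw [ht]

/-- Density of Schwartz functions gives pointwise convergence of the transforms, and Fatou's lemma
passes the identity to the limit as an inequality, which is all that is needed. -/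
theorem lintegral_enorm_dualGabor_sq_le (γ : 𝓢(E n, ℂ)) (h : L2 n) :
    ∫⁻ w, ‖dualGabor γ h w‖ₑ ^ 2 ≤ ‖h‖ₑ ^ 2 * ‖γ.toLp 2‖ₑ ^ 2 := by
  have hdense := SchwartzMap.denseRange_toLpCLM (E := E n) (F := ℂ) (p := 2) (by simp)
    (μ := volume)
  obtain ⟨u, hu, hlim⟩ := mem_closure_iff_seq_limit.1 (hdense h)
  choose ψ hψ using hu
  have hψ' : ∀ j, (ψ j).toLp 2 = u j := hψ
  have hD : ∀ j w, dualGabor γ (u j) w = dualGabor γ (ψ j) w := by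
    intro j w
    rw [← hψ' j]
    exact dualGabor_congr γ ((ψ j).coeFn_toLp 2 volume) w
  have hpt : ∀ w, Tendsto (fun j => ‖dualGabor γ (ψ j) w‖ₑ ^ 2) atTop
      (𝓝 (‖dualGabor γ h w‖ₑ ^ 2)) := by
    intro w
    have h1 : Tendsto (fun j => dualGabor γ (u j) w) atTop (𝓝 (dualGabor γ h w)) := by
      simp_rw [dualGabor_eq_inner]
      exact tendsto_const_nhds.inner hlim
    simp_rw [hD] at h1
    exact ((ENNReal.continuous_pow 2).tendsto _).comp h1.enorm
  have hint : ∀ j, ∫⁻ w, ‖dualGabor γ (ψ j) w‖ₑ ^ 2 = ‖u j‖ₑ ^ 2 * ‖γ.toLp 2‖ₑ ^ 2 := by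
    intro j
    rw [lintegral_enorm_dualGabor_sq_schwartz, ← enorm_toLp_two_sq, ← enorm_toLp_two_sq, hψ']
  have hnorm : Tendsto (fun j => ‖u j‖ₑ ^ 2 * ‖γ.toLp 2‖ₑ ^ 2) atTop
      (𝓝 (‖h‖ₑ ^ 2 * ‖γ.toLp 2‖ₑ ^ 2)) := by
    refine ENNReal.Tendsto.mul_const (((ENNReal.continuous_pow 2).tendsto _).comp hlim.enorm) ?_
    right
    exact (ENNReal.pow_lt_top enorm_lt_top).ne
  calc ∫⁻ w, ‖dualGabor γ h w‖ₑ ^ 2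
      = ∫⁻ w, liminf (fun j => ‖dualGabor γ (ψ j) w‖ₑ ^ 2) atTop :=
        lintegral_congr fun w => (hpt w).liminf_eq.symm
    _ ≤ liminf (fun j => ∫⁻ w, ‖dualGabor γ (ψ j) w‖ₑ ^ 2) atTop :=
        lintegral_liminf_le fun j => by
          have := continuous_dualGabor_schwartz γ (ψ j)
          fun_prop
    _ = _ := by simp_rw [hint]; exact hnorm.liminf_eq

end

end MixedMod

/-! ### Splitting variables -/

namespace MixedMod

open Filter Topology

noncomputable section

/-- Glue two families of reals along an equivalence of index types. -/
def gluePi {α β δ : Type*} (e : α ⊕ β ≃ δ) : ((α → ℝ) × (β → ℝ)) ≃ᵐ (δ → ℝ) :=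
  (MeasurableEquiv.sumPiEquivProdPi (fun _ : α ⊕ β => ℝ)).symm.trans
    (MeasurableEquiv.piCongrLeft (fun _ : δ => ℝ) e)

theorem gluePi_inl {α β δ : Type*} (e : α ⊕ β ≃ δ) (q : (α → ℝ) × (β → ℝ)) (a : α) :
    gluePi e q (e (Sum.inl a)) = q.1 a :=
  MeasurableEquiv.piCongrLeft_apply_apply (β := fun _ : δ => ℝ) e _ (Sum.inl a)

theorem gluePi_inr {α β δ : Type*} (e : α ⊕ β ≃ δ) (q : (α → ℝ) × (β → ℝ)) (b : β) :
    gluePi e q (e (Sum.inr b)) = q.2 b :=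
  MeasurableEquiv.piCongrLeft_apply_apply (β := fun _ : δ => ℝ) e _ (Sum.inr b)

theorem measurePreserving_gluePi {α β δ : Type*} [Fintype α] [Fintype β] [Fintype δ]
    (e : α ⊕ β ≃ δ) : MeasurePreserving (gluePi e) :=
  (volume_measurePreserving_piCongrLeft (fun _ : δ => ℝ) e).comp
    (volume_measurePreserving_sumPiEquivProdPi_symm (fun _ : α ⊕ β => ℝ))

/-- Glue two Euclidean vectors along an equivalence of index types. -/
def glueE {m n N : ℕ} (e : Fin m ⊕ Fin n ≃ Fin N) : (E m × E n) ≃ᵐ E N :=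
  ((MeasurableEquiv.toLp 2 (Fin m → ℝ)).symm.prodCongr
    (MeasurableEquiv.toLp 2 (Fin n → ℝ)).symm).trans
    ((gluePi e).trans (MeasurableEquiv.toLp 2 (Fin N → ℝ)))

theorem measurePreserving_glueE {m n N : ℕ} (e : Fin m ⊕ Fin n ≃ Fin N) :
    MeasurePreserving (glueE e) :=
  (PiLp.volume_preserving_toLp (Fin N)).comp ((measurePreserving_gluePi e).comp
    ((PiLp.volume_preserving_ofLp (Fin m)).prod (PiLp.volume_preserving_ofLp (Fin n))))

theorem glueE_finSumFinEquiv {m n : ℕ} (q : E m × E n) :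
    glueE finSumFinEquiv q = pair q.1 q.2 := by
  ext i
  refine Fin.addCases (fun j => ?_) (fun j => ?_) i
  · have := gluePi_inl finSumFinEquiv (q.1.ofLp, q.2.ofLp) j
    change gluePi finSumFinEquiv (q.1.ofLp, q.2.ofLp) (Fin.castAdd n j) = _
    simpa [pair] using this
  · have := gluePi_inr finSumFinEquiv (q.1.ofLp, q.2.ofLp) j
    change gluePi finSumFinEquiv (q.1.ofLp, q.2.ofLp) (Fin.natAdd m j) = _
    simpa [pair] using this

theorem coe_glueE_finSumFinEquiv {m n : ℕ} :
    ⇑(glueE (finSumFinEquiv (m := m) (n := n))) = fun q : E m × E n => pair q.1 q.2 :=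
  funext glueE_finSumFinEquiv

theorem measurePreserving_pair (m n : ℕ) :
    MeasurePreserving (fun q : E m × E n => pair q.1 q.2) := by
  rw [← coe_glueE_finSumFinEquiv]
  exact measurePreserving_glueE _

theorem measurableEmbedding_pair (m n : ℕ) :
    MeasurableEmbedding (fun q : E m × E n => pair q.1 q.2) := by
  rw [← coe_glueE_finSumFinEquiv]
  exact MeasurableEquiv.measurableEmbedding _

theorem inner_pair {m n : ℕ} (t x : E m) (s y : E n) :
    inner ℝ (pair t s) (pair x y) = inner ℝ t x + inner ℝ s y := by
  simp [PiLp.inner_apply, pair, Fin.sum_univ_add]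

theorem pair_sub_pair {m n : ℕ} (t x : E m) (s y : E n) :
    pair t s - pair x y = pair (t - x) (s - y) := by
  ext i
  refine Fin.addCases (fun j => ?_) (fun j => ?_) i <;> simp [pair]

/-- Interchange the two middle factors. -/
theorem measurePreserving_prodProdProdComm {α β δ ε : Type*} [MeasureSpace α] [MeasureSpace β]
    [MeasureSpace δ] [MeasureSpace ε] [SFinite (volume : Measure α)]
    [SFinite (volume : Measure β)] [SFinite (volume : Measure δ)] [SFinite (volume : Measure ε)] :
    MeasurePreserving (fun q : (α × β) × (δ × ε) => ((q.1.1, q.2.1), (q.1.2, q.2.2))) := by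
  have h1 : MeasurePreserving (fun q : (α × β) × (δ × ε) => (q.1.1, (q.1.2, q.2))) :=
    measurePreserving_prodAssoc volume volume volume
  have h2 : MeasurePreserving (fun q : β × (δ × ε) => (q.2.1, (q.1, q.2.2))) := by
    have a1 : MeasurePreserving (fun q : (β × δ) × ε => (q.1.1, (q.1.2, q.2))) :=
      measurePreserving_prodAssoc volume volume volume
    have a2 : MeasurePreserving (fun q : (δ × β) × ε => (q.1.1, (q.1.2, q.2))) :=
      measurePreserving_prodAssoc volume volume volume
    have a3 : MeasurePreserving (MeasurableEquiv.prodAssoc (α := β) (β := δ) (γ := ε)) := a1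
    have a4 : MeasurePreserving (fun q : (β × δ) × ε => (q.1.swap, q.2)) :=
      (Measure.measurePreserving_swap (μ := (volume : Measure β))
        (ν := (volume : Measure δ))).prod (MeasurePreserving.id volume)
    exact a2.comp (a4.comp a3.symm)
  have h3 : MeasurePreserving (fun q : α × (δ × (β × ε)) => ((q.1, q.2.1), q.2.2)) := by
    have a3 : MeasurePreserving (MeasurableEquiv.prodAssoc (α := α) (β := δ) (γ := β × ε)) :=
      measurePreserving_prodAssoc volume volume volume
    exact a3.symm
  exact h3.comp (((MeasurePreserving.id (volume : Measure α)).prod h2).comp h1)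

/-- Reorder `((x, ξ), (y, η))` to `((x, y), (ξ, η))`. -/
def mixPoint {d : ℕ} (q : (E d × E d) × (E d × E d)) : E (d + d) × E (d + d) :=
  (pair q.1.1 q.2.1, pair q.1.2 q.2.2)

theorem measurePreserving_mixPoint (d : ℕ) : MeasurePreserving (mixPoint (d := d)) :=
  ((measurePreserving_pair d d).prod (measurePreserving_pair d d)).comp
    measurePreserving_prodProdProdComm

theorem measurableEmbedding_mixPoint (d : ℕ) : MeasurableEmbedding (mixPoint (d := d)) := by
  have h : MeasurableEmbedding (fun q : (E d × E d) × (E d × E d) =>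
      ((q.1.1, q.2.1), (q.1.2, q.2.2))) := by
    let e : (E d × E d) × (E d × E d) ≃ᵐ (E d × E d) × (E d × E d) :=
      { toEquiv := Equiv.prodProdProdComm _ _ _ _
        measurable_toFun := by
          change Measurable fun q : (E d × E d) × (E d × E d) => ((q.1.1, q.2.1), (q.1.2, q.2.2))
          fun_prop
        measurable_invFun := by
          change Measurable fun q : (E d × E d) × (E d × E d) => ((q.1.1, q.2.1), (q.1.2, q.2.2))
          fun_prop }
    exact e.measurableEmbedding
  exact ((measurableEmbedding_pair d d).prodMap (measurableEmbedding_pair d d)).comp h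

theorem lintegral_mul_sq_le {α : Type*} [MeasurableSpace α] {μ : Measure α} {f g : α → ℝ≥0∞}
    (hf : AEMeasurable f μ) (hg : AEMeasurable g μ) :
    (∫⁻ x, f x * g x ∂μ) ^ 2 ≤ (∫⁻ x, f x ^ 2 ∂μ) * ∫⁻ x, g x ^ 2 ∂μ := by
  have h := ENNReal.lintegral_mul_norm_pow_le (hf.pow_const 2) (hg.pow_const 2)
    (p := 1 / 2) (q := 1 / 2) (by norm_num) (by norm_num) (by norm_num)
  have e : ∀ a : ℝ≥0∞, (a ^ 2) ^ (1 / 2 : ℝ) = a := by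
    intro a
    rw [← ENNReal.rpow_natCast, ← ENNReal.rpow_mul]
    norm_num
  have e' : ∀ a : ℝ≥0∞, (a ^ (1 / 2 : ℝ)) ^ 2 = a := by
    intro a
    rw [← ENNReal.rpow_natCast, ← ENNReal.rpow_mul]
    norm_num
  simp_rw [e] at h
  calc _ ≤ _ := pow_le_pow_left' h 2
    _ = _ := by rw [mul_pow, e', e']

/-! ### Integral operators with square-integrable kernels -/

section HilbertSchmidt

variable {α β : Type*} [MeasurableSpace α] [MeasurableSpace β] {μ : Measure α} {ν : Measure β}
  [SFinite ν] {K : α × β → ℂ}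

theorem ae_integrable_kernel_mul (hK : MemLp K 2 (μ.prod ν)) {f : β → ℂ} (hf : MemLp f 2 ν) :
    ∀ᵐ t ∂μ, Integrable (fun y => K (t, y) * f y) ν := by
  have h1 : ∫⁻ t, ∫⁻ y, ‖K (t, y)‖ₑ ^ 2 ∂ν ∂μ < ∞ := by
    rw [← lintegral_prod _ (hK.1.enorm.pow_const 2), ← eLpNorm_two_sq]
    exact ENNReal.pow_lt_top hK.2
  have h2 : AEMeasurable (fun t => ∫⁻ y, ‖K (t, y)‖ₑ ^ 2 ∂ν) μ :=
    (hK.1.enorm.pow_const 2).lintegral_prod_right'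
  filter_upwards [ae_lt_top' h2 h1.ne, hK.1.prodMk_left] with t ht hm
  have : MemLp (fun y => K (t, y)) 2 ν := by
    refine ⟨hm, ?_⟩
    rw [← eLpNorm_two_sq] at ht
    exact lt_of_not_ge fun h => by simp [top_le_iff.1 h] at ht
  exact this.integrable_mul hf

theorem aestronglyMeasurable_kernel_integral (hK : MemLp K 2 (μ.prod ν)) {f : β → ℂ}
    (hf : MemLp f 2 ν) : AEStronglyMeasurable (fun t => ∫ y, K (t, y) * f y ∂ν) μ :=
  (hK.1.mul hf.1.comp_snd).integral_prod_right'

theorem lintegral_enorm_kernel_integral_sq_le (hK : MemLp K 2 (μ.prod ν)) {f : β → ℂ}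
    (hf : MemLp f 2 ν) :
    ∫⁻ t, ‖∫ y, K (t, y) * f y ∂ν‖ₑ ^ 2 ∂μ ≤ eLpNorm K 2 (μ.prod ν) ^ 2 * eLpNorm f 2 ν ^ 2 := by
  rw [eLpNorm_two_sq, eLpNorm_two_sq, lintegral_prod _ (hK.1.enorm.pow_const 2)]
  rw [← lintegral_mul_const'' _ (hK.1.enorm.pow_const 2).lintegral_prod_right']
  refine lintegral_mono_ae ?_
  filter_upwards [hK.1.prodMk_left] with t hm
  calc ‖∫ y, K (t, y) * f y ∂ν‖ₑ ^ 2 ≤ (∫⁻ y, ‖K (t, y)‖ₑ * ‖f y‖ₑ ∂ν) ^ 2 := by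
        refine pow_le_pow_left' ((enorm_integral_le_lintegral_enorm _).trans_eq ?_) 2
        simp_rw [enorm_mul]
    _ ≤ _ := lintegral_mul_sq_le hm.enorm hf.1.enorm

theorem memLp_kernel_integral (hK : MemLp K 2 (μ.prod ν)) {f : β → ℂ} (hf : MemLp f 2 ν) :
    MemLp (fun t => ∫ y, K (t, y) * f y ∂ν) 2 μ := by
  refine ⟨aestronglyMeasurable_kernel_integral hK hf, ?_⟩
  have h := lintegral_enorm_kernel_integral_sq_le hK hf
  rw [← eLpNorm_two_sq] at h
  have h' := h.trans_lt (ENNReal.mul_lt_top (ENNReal.pow_lt_top hK.2) (ENNReal.pow_lt_top hf.2))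
  exact lt_of_not_ge fun h => by simp [top_le_iff.1 h] at h'

theorem memLp_mul_prod {g : α → ℂ} {f : β → ℂ} (hg : MemLp g 2 μ) (hf : MemLp f 2 ν) :
    MemLp (fun q : α × β => g q.1 * f q.2) 2 (μ.prod ν) := by
  refine ⟨hg.1.comp_fst.mul hf.1.comp_snd, ?_⟩
  have h : eLpNorm (fun q : α × β => g q.1 * f q.2) 2 (μ.prod ν) ^ 2 < ∞ := by
    rw [eLpNorm_two_sq]
    simp_rw [enorm_mul, mul_pow]
    rw [lintegral_prod_mul (hg.1.enorm.pow_const 2) (hf.1.enorm.pow_const 2), ← eLpNorm_two_sq,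
      ← eLpNorm_two_sq]
    exact ENNReal.mul_lt_top (ENNReal.pow_lt_top hg.2) (ENNReal.pow_lt_top hf.2)
  exact lt_of_not_ge fun h' => by simp [top_le_iff.1 h'] at h

end HilbertSchmidt

/-! ### Tensor product windows -/

section Tensor

variable {d : ℕ} {γ : 𝓢(E (d + d), ℂ)} {γ₁ γ₂ : 𝓢(E d, ℂ)}

theorem timeFreqShift_pair (hγ : ∀ t s, γ (pair t s) = γ₁ t * γ₂ s) (x y ξ η t s : E d) :
    timeFreqShift γ (pair x y) (pair ξ η) (pair t s) =
      timeFreqShift γ₁ x ξ t * timeFreqShift γ₂ y η s := by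
  simp only [timeFreqShift_apply, pair_sub_pair, hγ, inner_pair]
  rw [Complex.ofReal_add, mul_add, Complex.exp_add]
  ring

theorem memLp_comp_pair {f : E (d + d) → ℂ} (hf : MemLp f 2) :
    MemLp (fun q : E d × E d => f (pair q.1 q.2)) 2 (volume.prod volume) :=
  hf.comp_measurePreserving (measurePreserving_pair d d)

theorem eLpNorm_comp_pair {f : E (d + d) → ℂ} (hf : AEStronglyMeasurable f) :
    eLpNorm (fun q : E d × E d => f (pair q.1 q.2)) 2 (volume.prod volume) = eLpNorm f 2 volume :=
  eLpNorm_comp_measurePreserving hf (measurePreserving_pair d d)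

/-- For a tensor window the transform can be taken one variable at a time: pairing in `s` leaves a
function of `t`, to which the transform with window `γ₁` applies. -/
theorem dualGabor_mixPoint (hγ : ∀ t s, γ (pair t s) = γ₁ t * γ₂ s) (ψ : L2 (d + d))
    (v z : E d × E d) :
    dualGabor γ ψ (mixPoint (v, z)) =
      dualGabor γ₁ (fun t => ∫ s, ψ (pair t s) * timeFreqShift γ₂ z.1 z.2 s) v := by
  rw [dualGabor, ← (measurePreserving_pair d d).integral_comp (measurableEmbedding_pair d d)]
  have hi : Integrable (fun q : E d × E d => ψ (pair q.1 q.2) *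
      timeFreqShift γ (mixPoint (v, z)).1 (mixPoint (v, z)).2 (pair q.1 q.2))
      (volume.prod volume) := by
    have : Integrable (fun t => ψ t * timeFreqShift γ (mixPoint (v, z)).1 (mixPoint (v, z)).2 t) :=
      (Lp.memLp ψ).integrable_mul (SchwartzMap.memLp _ 2 volume)
    exact (measurePreserving_pair d d).integrable_comp_of_integrable this
  rw [Measure.volume_eq_prod, integral_prod _ hi, dualGabor]
  refine integral_congr_ae (ae_of_all _ fun t => ?_)
  simp only [mixPoint]
  rw [← integral_mul_const]
  refine integral_congr_ae (ae_of_all _ fun s => ?_)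
  simp only
  rw [timeFreqShift_pair hγ]
  ring

/-- The `L^{2,∞}` bound, the reason for tensor windows. Pairing `ψ` in its second variable with a
shift of `γ₂` costs `‖γ₂‖` by Cauchy–Schwarz, whatever `z` is; the `L²` bound with window `γ₁` does
the rest. -/
theorem lintegral_enorm_dualGabor_mixPoint_sq_le (hγ : ∀ t s, γ (pair t s) = γ₁ t * γ₂ s)
    (ψ : L2 (d + d)) (z : E d × E d) :
    ∫⁻ v, ‖dualGabor γ ψ (mixPoint (v, z))‖ₑ ^ 2 ≤
      ‖ψ‖ₑ ^ 2 * (‖γ₁.toLp 2‖ₑ ^ 2 * ‖γ₂.toLp 2‖ₑ ^ 2) := by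
  have hT : MemLp (timeFreqShift γ₂ z.1 z.2) 2 := SchwartzMap.memLp _ 2 volume
  have hψ := memLp_comp_pair (Lp.memLp ψ)
  have hm := memLp_kernel_integral hψ hT
  obtain ⟨Ψ, hΨ⟩ : ∃ Ψ : L2 d, Ψ =ᵐ[volume]
      fun t => ∫ s, ψ (pair t s) * timeFreqShift γ₂ z.1 z.2 s := ⟨hm.toLp _, hm.coeFn_toLp⟩
  have h1 : ∀ v, dualGabor γ ψ (mixPoint (v, z)) = dualGabor γ₁ Ψ v := by
    intro v
    rw [dualGabor_mixPoint hγ]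
    exact dualGabor_congr γ₁ hΨ.symm v
  have h2 : ‖Ψ‖ₑ ^ 2 ≤ ‖ψ‖ₑ ^ 2 * ‖γ₂.toLp 2‖ₑ ^ 2 := by
    have h3 : eLpNorm (timeFreqShift γ₂ z.1 z.2) 2 volume ^ 2 = ‖γ₂.toLp 2‖ₑ ^ 2 := by
      rw [eLpNorm_two_sq, enorm_toLp_two_sq]
      simp_rw [enorm_timeFreqShift_apply]
      exact lintegral_sub_right_eq_self (fun s => ‖γ₂ s‖ₑ ^ 2) z.1
    have h4 := lintegral_enorm_kernel_integral_sq_le hψ hT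
    rw [h3, eLpNorm_comp_pair (Lp.aestronglyMeasurable ψ), ← Lp.enorm_def] at h4
    rw [enorm_L2_sq]
    refine le_trans (le_of_eq (lintegral_congr_ae ?_)) h4
    filter_upwards [hΨ] with t ht
    rw [ht]
  have h5 : ∫⁻ v, ‖dualGabor γ ψ (mixPoint (v, z))‖ₑ ^ 2 ≤ ‖Ψ‖ₑ ^ 2 * ‖γ₁.toLp 2‖ₑ ^ 2 := by
    simp_rw [h1]
    exact lintegral_enorm_dualGabor_sq_le γ₁ Ψ
  refine h5.trans ?_
  rw [mul_comm (‖γ₁.toLp 2 volume‖ₑ ^ 2), ← mul_assoc]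
  exact mul_le_mul' h2 le_rfl

theorem lintegral_lintegral_enorm_dualGabor_mixPoint_sq_le (γ : 𝓢(E (d + d), ℂ))
    (ψ : L2 (d + d)) :
    ∫⁻ z, ∫⁻ v, ‖dualGabor γ ψ (mixPoint (v, z))‖ₑ ^ 2 ≤ ‖ψ‖ₑ ^ 2 * ‖γ.toLp 2‖ₑ ^ 2 := by
  have hm : Measurable fun w => ‖dualGabor γ ψ w‖ₑ ^ 2 :=
    (continuous_dualGabor γ ψ).measurable.enorm.pow_const 2
  refine le_trans (le_of_eq ?_) (lintegral_enorm_dualGabor_sq_le γ ψ)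
  rw [← (measurePreserving_mixPoint d).lintegral_comp hm, Measure.volume_eq_prod]
  exact (lintegral_prod_symm' _ (hm.comp (measurePreserving_mixPoint d).measurable)).symm

theorem dualGabor_mul_mixPoint (hγ : ∀ t s, γ (pair t s) = γ₁ t * γ₂ s) {ψ : L2 (d + d)}
    {g f : E d → ℂ} (hψ : ∀ᵐ q : E d × E d, ψ (pair q.1 q.2) = g q.1 * f q.2) (v z : E d × E d) :
    dualGabor γ ψ (mixPoint (v, z)) = dualGabor γ₁ g v * dualGabor γ₂ f z := by
  rw [dualGabor, ← (measurePreserving_pair d d).integral_comp (measurableEmbedding_pair d d)]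
  rw [dualGabor, dualGabor, ← integral_prod_mul, ← Measure.volume_eq_prod]
  refine integral_congr_ae ?_
  filter_upwards [hψ] with q hq
  rw [hq, mixPoint, timeFreqShift_pair hγ]
  ring

end Tensor

end

end MixedMod

/-! ### Mixed norms -/

namespace MixedMod

open Filter Topology

noncomputable section

theorem eLpNorm_ofReal_rpow {α : Type*} [MeasurableSpace α] {μ : Measure α} (f : α → ℝ≥0∞)
    {q : ℝ} (hq : 0 < q) :
    eLpNorm f (ENNReal.ofReal q) μ ^ q = ∫⁻ t, f t ^ q ∂μ := by
  rw [eLpNorm_eq_lintegral_rpow_enorm_toReal (by simpa using hq) (by simp),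
    ENNReal.toReal_ofReal hq.le, ← ENNReal.rpow_mul]
  simp [hq.ne']

theorem measurable_finCons {n : ℕ} :
    Measurable fun q : ℝ × (Fin n → ℝ) => (Fin.cons q.1 q.2 : Fin (n + 1) → ℝ) := by
  rw [measurable_pi_iff]
  intro i
  refine Fin.cases ?_ (fun j => ?_) i
  · simpa using measurable_fst
  · simp only [Fin.cons_succ]
    exact (measurable_pi_apply j).comp measurable_snd

theorem measurePreserving_finCons {n : ℕ} :
    MeasurePreserving fun q : ℝ × (Fin n → ℝ) => (Fin.cons q.1 q.2 : Fin (n + 1) → ℝ) := by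
  have h := (volume_preserving_piFinSuccAbove (fun _ : Fin (n + 1) => ℝ) 0).symm
  convert h using 1
  funext q
  simp [MeasurableEquiv.piFinSuccAbove]
  rfl

theorem mixedNorm_const {q : ℝ} (hq : 0 < q) (n : ℕ) (F : (Fin n → ℝ) → ℝ≥0∞)
    (hF : Measurable F) :
    mixedNorm n (fun _ => ENNReal.ofReal q) F = (∫⁻ x, F x ^ q) ^ (1 / q) := by
  induction n with
  | zero =>
    rw [mixedNorm, Measure.volume_pi_eq_dirac (Fin.elim0), lintegral_dirac' _ (hF.pow_const q),
      ← ENNReal.rpow_mul]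
    simp [hq.ne']
  | succ n ih =>
    have hm : Measurable fun q : ℝ × (Fin n → ℝ) => F (Fin.cons q.1 q.2) :=
      hF.comp measurable_finCons
    have hm' : Measurable fun x : Fin n → ℝ => ∫⁻ t : ℝ, F (Fin.cons t x) ^ q :=
      (hm.pow_const q).lintegral_prod_left'
    have he : (fun x : Fin n → ℝ => eLpNorm (fun t : ℝ => F (Fin.cons t x))
        (ENNReal.ofReal q) volume) = fun x => (∫⁻ t : ℝ, F (Fin.cons t x) ^ q) ^ (1 / q) := by
      funext x
      rw [← eLpNorm_ofReal_rpow _ hq, ← ENNReal.rpow_mul]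
      simp [hq.ne']
    rw [mixedNorm, he, ih _ (hm'.pow_const _)]
    congr 1
    rw [← measurePreserving_finCons.lintegral_comp (hF.pow_const q), Measure.volume_eq_prod,
      lintegral_prod_symm' _ (hm.pow_const q)]
    refine lintegral_congr fun x => ?_
    rw [← ENNReal.rpow_mul]
    simp [hq.ne']

/-- Needed because `m + 1 + n` and `m + n + 1`, or `0 + n` and `n`, are not definitionally equal. -/
theorem mixedNorm_cast {N N' : ℕ} (h : N = N') (p : Fin N → ℝ≥0∞) (F : (Fin N → ℝ) → ℝ≥0∞) :
    mixedNorm N p F =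
      mixedNorm N' (fun i => p (Fin.cast h.symm i)) (fun x => F (fun i => x (Fin.cast h i))) := by
  subst h
  rfl

/-- Induction on the inner block, since the recursion of `mixedNorm` removes the innermost variable
first. -/
theorem mixedNorm_append {n : ℕ} (b : Fin n → ℝ≥0∞) (m : ℕ) (a : Fin m → ℝ≥0∞)
    (F : (Fin (m + n) → ℝ) → ℝ≥0∞) :
    mixedNorm (m + n) (Fin.append a b) F =
      mixedNorm n b fun y => mixedNorm m a fun x => F (Fin.append x y) := by
  induction m with
  | zero =>
    rw [mixedNorm_cast (Nat.zero_add n)]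
    congr 1
    · funext i
      rw [show Fin.cast (Nat.zero_add n).symm i = Fin.natAdd 0 i from Fin.ext (by simp),
        Fin.append_right]
    · funext x
      rw [mixedNorm]
      congr 1
      funext i
      have : i = Fin.natAdd 0 (Fin.cast (Nat.zero_add n) i) := Fin.ext (by simp)
      conv_rhs => rw [this]
      rw [Fin.append_right]
  | succ m ih =>
    have hN : m + 1 + n = m + n + 1 := by omega
    rw [mixedNorm_cast hN, mixedNorm]
    have h0 : Fin.append a b (Fin.cast hN.symm 0) = a 0 := by
      rw [show Fin.cast hN.symm 0 = Fin.castAdd n 0 from Fin.ext (by simp), Fin.append_left]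
    have hs : (fun i : Fin (m + n) => Fin.append a b (Fin.cast hN.symm i.succ)) =
        Fin.append (fun i => a i.succ) b := by
      funext i
      refine Fin.addCases (fun j => ?_) (fun j => ?_) i
      · rw [show Fin.cast hN.symm (Fin.castAdd n j).succ = Fin.castAdd n j.succ from
          Fin.ext (by simp), Fin.append_left, Fin.append_left]
      · rw [show Fin.cast hN.symm (Fin.natAdd m j).succ = Fin.natAdd (m + 1) j from
          Fin.ext (by simp; omega), Fin.append_right, Fin.append_right]
    rw [hs, h0, ih]
    congr 1
    funext y
    rw [mixedNorm]
    congr 1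
    funext x
    congr 1
    funext t
    congr 1
    funext i
    refine Fin.addCases (fun j => ?_) (fun j => ?_) i
    · rw [Fin.append_left]
      refine Fin.cases ?_ (fun l => ?_) j
      · rw [show Fin.cast hN (Fin.castAdd n 0) = 0 from Fin.ext (by simp), Fin.cons_zero,
          Fin.cons_zero]
      · rw [show Fin.cast hN (Fin.castAdd n l.succ) = (Fin.castAdd n l).succ from
          Fin.ext (by simp), Fin.cons_succ, Fin.cons_succ, Fin.append_left]
    · rw [Fin.append_right, show Fin.cast hN (Fin.natAdd (m + 1) j) = (Fin.natAdd m j).succ from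
        Fin.ext (by simp; omega), Fin.cons_succ, Fin.append_right]

theorem measurable_finAppend {m n : ℕ} :
    Measurable fun q : (Fin m → ℝ) × (Fin n → ℝ) => (Fin.append q.1 q.2 : Fin (m + n) → ℝ) := by
  rw [measurable_pi_iff]
  intro i
  refine Fin.addCases (fun j => ?_) (fun j => ?_) i
  · simp only [Fin.append_left]
    exact (measurable_pi_apply j).comp measurable_fst
  · simp only [Fin.append_right]
    exact (measurable_pi_apply j).comp measurable_snd

theorem mixedNorm_two_append {m n : ℕ} {p : ℝ} (hp : 0 < p) {F : (Fin (m + n) → ℝ) → ℝ≥0∞}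
    (hF : Measurable F) :
    mixedNorm (m + n) (Fin.append (fun _ => 2) (fun _ => ENNReal.ofReal p)) F =
      (∫⁻ y, (∫⁻ x, F (Fin.append x y) ^ 2) ^ (p / 2)) ^ (1 / p) := by
  have hFa : Measurable fun q : (Fin m → ℝ) × (Fin n → ℝ) => F (Fin.append q.1 q.2) :=
    hF.comp measurable_finAppend
  have h2 : ∀ y, mixedNorm m (fun _ => 2) (fun x => F (Fin.append x y)) =
      (∫⁻ x, F (Fin.append x y) ^ 2) ^ (1 / 2 : ℝ) := by
    intro y
    have := mixedNorm_const (q := 2) (by norm_num) m (fun x => F (Fin.append x y))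
      (hFa.comp (measurable_id.prodMk measurable_const))
    rw [show ENNReal.ofReal 2 = 2 by simp] at this
    rw [this]
    congr 1
    refine lintegral_congr fun x => ?_
    exact_mod_cast ENNReal.rpow_natCast _ 2
  rw [mixedNorm_append]
  simp_rw [h2]
  rw [mixedNorm_const hp]
  · congr 1
    refine lintegral_congr fun y => ?_
    rw [← ENNReal.rpow_mul]
    congr 1
    ring
  · exact ((hFa.pow_const 2).lintegral_prod_left').pow_const _

/-- `e₁` records where the coordinates of `x` (`inl`) and `ξ` (`inr`) sit inside the inner block,
and `e₂` does the same for `y` and `η` in the outer block. -/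
theorem IsSlicePermutation.exists_equiv {d : ℕ} {c : Equiv.Perm (Fin ((d + d) + (d + d)))}
    (hc : IsSlicePermutation d c) : ∃ e₁ e₂ : Fin d ⊕ Fin d ≃ Fin (d + d),
      (∀ i, c (Fin.castAdd (d + d) (Fin.castAdd d i)) = Fin.castAdd (d + d) (e₁ (Sum.inl i))) ∧
      (∀ i, c (Fin.natAdd (d + d) (Fin.castAdd d i)) = Fin.castAdd (d + d) (e₁ (Sum.inr i))) ∧
      (∀ i, c (Fin.castAdd (d + d) (Fin.natAdd d i)) = Fin.natAdd (d + d) (e₂ (Sum.inl i))) ∧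
      (∀ i, c (Fin.natAdd (d + d) (Fin.natAdd d i)) = Fin.natAdd (d + d) (e₂ (Sum.inr i))) := by
  -- An injection between sets of `2d` elements is a bijection, so only one inclusion of ranges has
  -- to be checked.
  have key : ∀ (f : Fin d ⊕ Fin d → Fin ((d + d) + (d + d))), Function.Injective f →
      ∀ (g : Fin (d + d) → Fin ((d + d) + (d + d))),
      (∀ j, ∃ i, c (f j) = g i) → ∃ e : Fin d ⊕ Fin d ≃ Fin (d + d), ∀ j, c (f j) = g (e j) := by
    intro f hf g h
    choose u hu using h
    have hinj : Function.Injective u := fun a b hab =>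
      hf (c.injective (by rw [hu, hu, hab]))
    exact ⟨Equiv.ofBijective u ((Fintype.bijective_iff_injective_and_card u).2 ⟨hinj, by simp⟩), hu⟩
  obtain ⟨e₁, h₁⟩ := key (Sum.elim (fun i => Fin.castAdd (d + d) (Fin.castAdd d i))
      (fun i => Fin.natAdd (d + d) (Fin.castAdd d i)))
    (by
      rintro (a | a) (b | b) h <;> simp [Fin.ext_iff] at h ⊢ <;> omega)
    (Fin.castAdd (d + d)) (by
      intro j
      set x := (Sum.elim (fun i => Fin.castAdd (d + d) (Fin.castAdd d i))
        (fun i => Fin.natAdd (d + d) (Fin.castAdd d i)) j) with hx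
      have hj : c x ∈ _ := hc.1.mapsTo (by
          rcases j with a | a <;> simp [hx] <;> omega)
      simp only [Set.mem_ofPred_eq] at hj
      exact ⟨⟨(c x).val, by omega⟩, Fin.ext rfl⟩)
  obtain ⟨e₂, h₂⟩ := key (Sum.elim (fun i => Fin.castAdd (d + d) (Fin.natAdd d i))
      (fun i => Fin.natAdd (d + d) (Fin.natAdd d i)))
    (by
      rintro (a | a) (b | b) h <;> simp [Fin.ext_iff] at h ⊢ <;> omega)
    (Fin.natAdd (d + d)) (by
      intro j
      set x := (Sum.elim (fun i => Fin.castAdd (d + d) (Fin.natAdd d i))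
        (fun i => Fin.natAdd (d + d) (Fin.natAdd d i)) j) with hx
      have hj : c x ∈ _ := hc.2.mapsTo (by
          rcases j with a | a <;> simp [hx] <;> omega)
      simp only [Set.mem_ofPred_eq] at hj
      exact ⟨⟨(c x).val - (d + d), by omega⟩, Fin.ext (by simp; omega)⟩)
  exact ⟨e₁, e₂, fun i => h₁ (Sum.inl i), fun i => h₁ (Sum.inr i), fun i => h₂ (Sum.inl i),
    fun i => h₂ (Sum.inr i)⟩

theorem measurable_toLp_comp {m n : ℕ} (g : Fin m → Fin n) :
    Measurable fun z : Fin n → ℝ => (WithLp.toLp 2 (fun i => z (g i)) : E m) := by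
  have h : Measurable fun z : Fin n → ℝ => (fun i => z (g i)) :=
    measurable_pi_iff.2 fun i => measurable_pi_apply (g i)
  exact (MeasurableEquiv.toLp 2 (Fin m → ℝ)).measurable.comp h

theorem measurable_gaborTransform {n : ℕ} (φ : 𝓢(E n, ℂ)) (k : 𝓢'(E n, ℂ)) :
    Measurable fun w : E n × E n => gaborTransform φ k w.1 w.2 :=
  (continuous_gaborTransform φ k).measurable

theorem measurable_gaborTransformFlat {n : ℕ} (φ : 𝓢(E n, ℂ)) (k : 𝓢'(E n, ℂ)) :
    Measurable (gaborTransformFlat φ k) := by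
  have h := (measurable_toLp_comp (Fin.castAdd n)).prodMk (measurable_toLp_comp (Fin.natAdd n))
  have h' := (measurable_gaborTransform φ k).comp h
  exact h'

/-- Within each block the exponents are constant, so the order of the coordinates there is
immaterial and regluing them by `e₁` and `e₂` preserves the measure. -/
theorem lintegral_gaborTransform_mixPoint_lt_top {d : ℕ}
    {c : Equiv.Perm (Fin ((d + d) + (d + d)))} (hc : IsSlicePermutation d c) {p : ℝ} (hp : 0 < p)
    {φ : 𝓢(E (d + d), ℂ)} {k : 𝓢'(E (d + d), ℂ)}
    (hk : k ∈ mixedModulationSpace φ c (Fin.append (fun _ : Fin (d + d) => (2 : ℝ≥0∞))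
        (fun _ : Fin (d + d) => ENNReal.ofReal p))) :
    ∫⁻ z : E d × E d, (∫⁻ v : E d × E d, ‖gaborTransform φ k (mixPoint (v, z)).1
      (mixPoint (v, z)).2‖ₑ ^ 2) ^ (p / 2) < ∞ := by
  set F : (Fin ((d + d) + (d + d)) → ℝ) → ℝ≥0∞ :=
    fun x => ‖gaborTransformFlat φ k (fun i => x (c i))‖ₑ with hFdef
  have hF : Measurable F := ((measurable_gaborTransformFlat φ k).comp
    (measurable_pi_iff.2 fun i => measurable_pi_apply _)).enorm
  have hFa : Measurable fun q : (Fin (d + d) → ℝ) × (Fin (d + d) → ℝ) => F (Fin.append q.1 q.2) :=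
    hF.comp measurable_finAppend
  have hk' : mixedNorm ((d + d) + (d + d)) _ F < ∞ := hk
  rw [mixedNorm_two_append hp hF] at hk'
  have hfin : ∫⁻ y, (∫⁻ x, F (Fin.append x y) ^ 2) ^ (p / 2) < ∞ := by
    refine lt_of_not_ge fun h => ?_
    rw [top_le_iff.1 h, ENNReal.top_rpow_of_pos (by positivity)] at hk'
    exact lt_irrefl _ hk'
  obtain ⟨e₁, e₂, h1, h2, h3, h4⟩ := hc.exists_equiv
  have hT : ∀ e : Fin d ⊕ Fin d ≃ Fin (d + d),
      MeasurePreserving (fun v : E d × E d => (glueE e v).ofLp) := fun e =>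
    (PiLp.volume_preserving_ofLp (Fin (d + d))).comp (measurePreserving_glueE e)
  have hl : ∀ (e : Fin d ⊕ Fin d ≃ Fin (d + d)) (v : E d × E d) (i : Fin d),
      (glueE e v).ofLp (e (Sum.inl i)) = v.1 i := fun e v i =>
    gluePi_inl e (v.1.ofLp, v.2.ofLp) i
  have hr : ∀ (e : Fin d ⊕ Fin d ≃ Fin (d + d)) (v : E d × E d) (i : Fin d),
      (glueE e v).ofLp (e (Sum.inr i)) = v.2 i := fun e v i =>
    gluePi_inr e (v.1.ofLp, v.2.ofLp) i
  have hval : ∀ v z : E d × E d, ‖gaborTransform φ k (mixPoint (v, z)).1 (mixPoint (v, z)).2‖ₑ =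
      F (Fin.append (glueE e₁ v).ofLp (glueE e₂ z).ofLp) := by
    intro v z
    simp only [hFdef, gaborTransformFlat, mixPoint]
    congr 2
    · ext i
      refine Fin.addCases (fun j => ?_) (fun j => ?_) i
      · simp only [pair, h1, Fin.append_left, hl]
      · simp only [pair, h3, Fin.append_right, hl]
    · ext i
      refine Fin.addCases (fun j => ?_) (fun j => ?_) i
      · simp only [pair, h2, Fin.append_left, hr]
      · simp only [pair, h4, Fin.append_right, hr]
  simp_rw [hval]
  have hin : ∀ y, ∫⁻ v : E d × E d, F (Fin.append (glueE e₁ v).ofLp y) ^ 2 =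
      ∫⁻ x, F (Fin.append x y) ^ 2 := fun y =>
    (hT e₁).lintegral_comp (f := fun x => F (Fin.append x y) ^ 2)
      ((hFa.comp (measurable_id.prodMk measurable_const)).pow_const 2)
  simp_rw [hin]
  rw [(hT e₂).lintegral_comp (f := fun y => (∫⁻ x, F (Fin.append x y) ^ 2) ^ (p / 2))
    (((hFa.pow_const 2).lintegral_prod_left').pow_const _)]
  exact hfin

end

end MixedMod

namespace MixedMod

open Filter Topology

noncomputable section

/-! ### Tensor product windows that are not orthogonal to a given window -/

/-- The first component of a point of `ℝ^(m+n)`. -/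
def fstE {m n : ℕ} (z : E (m + n)) : E m := WithLp.toLp 2 fun i => z (Fin.castAdd n i)

/-- The second component of a point of `ℝ^(m+n)`. -/
def sndE {m n : ℕ} (z : E (m + n)) : E n := WithLp.toLp 2 fun i => z (Fin.natAdd m i)

theorem fstE_pair {m n : ℕ} (t : E m) (s : E n) : fstE (pair t s) = t := by
  ext i
  simp [fstE, pair]

theorem sndE_pair {m n : ℕ} (t : E m) (s : E n) : sndE (pair t s) = s := by
  ext i
  simp only [sndE, pair, Fin.append_right]

theorem pair_fstE_sndE {m n : ℕ} (z : E (m + n)) : pair (fstE z) (sndE z) = z := by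
  ext i
  refine Fin.addCases (fun j => ?_) (fun j => ?_) i
  · simp only [pair, fstE, Fin.append_left]
  · simp only [pair, sndE, Fin.append_right]

theorem contDiff_fstE {m n : ℕ} {r : WithTop ℕ∞} :
    ContDiff ℝ r (fstE : E (m + n) → E m) := by
  rw [contDiff_euclidean]
  intro i
  exact contDiff_euclidean.1 contDiff_id (Fin.castAdd n i)

theorem contDiff_sndE {m n : ℕ} {r : WithTop ℕ∞} :
    ContDiff ℝ r (sndE : E (m + n) → E n) := by
  rw [contDiff_euclidean]
  intro i
  exact contDiff_euclidean.1 contDiff_id (Fin.natAdd m i)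

theorem norm_pair_sq {m n : ℕ} (t : E m) (s : E n) : ‖pair t s‖ ^ 2 = ‖t‖ ^ 2 + ‖s‖ ^ 2 := by
  rw [← real_inner_self_eq_norm_sq, inner_pair, real_inner_self_eq_norm_sq,
    real_inner_self_eq_norm_sq]

theorem norm_pair_le {m n : ℕ} (t : E m) (s : E n) : ‖pair t s‖ ≤ ‖t‖ + ‖s‖ := by
  refine le_of_sq_le_sq ?_ (by positivity)
  rw [norm_pair_sq]
  nlinarith [norm_nonneg t, norm_nonneg s, mul_nonneg (norm_nonneg t) (norm_nonneg s)]

/-- Near a point `z₀` with `φ z₀ ≠ 0` the real part of `φ z₀ * conj (φ z)` stays positive. A product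
of bumps concentrated there gives an integral which, multiplied by `φ z₀`, has positive real part.
-/
theorem exists_tensor_window {d : ℕ} {φ : 𝓢(E (d + d), ℂ)} (hφ : φ ≠ 0) :
    ∃ (γ : 𝓢(E (d + d), ℂ)) (γ₁ γ₂ : 𝓢(E d, ℂ)), (∀ t s, γ (pair t s) = γ₁ t * γ₂ s) ∧
      ∫ z, γ z * (starRingEnd ℂ) (φ z) ≠ 0 := by
  obtain ⟨z₀, hz₀⟩ : ∃ z₀, φ z₀ ≠ 0 := by
    by_contra! h
    exact hφ (SchwartzMap.ext fun z => by simpa using h z)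
  set t₀ : E d := fstE z₀
  set s₀ : E d := sndE z₀
  have hcont : Continuous fun z => (φ z₀ * (starRingEnd ℂ) (φ z)).re :=
    Complex.continuous_re.comp (continuous_const.mul
      (Complex.continuous_conj.comp φ.continuous))
  have hpos : 0 < (φ z₀ * (starRingEnd ℂ) (φ z₀)).re := by
    rw [Complex.mul_conj, Complex.ofReal_re]
    exact Complex.normSq_pos.2 hz₀
  obtain ⟨δ, hδ, hball⟩ := Metric.eventually_nhds_iff_ball.1
    (hcont.continuousAt.eventually (lt_mem_nhds hpos))
  -- Outer radius `δ / 2` in each component places the support of the product in the ball of radius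
  -- `δ`, since `‖pair t s‖ ≤ ‖t‖ + ‖s‖`.
  let b₁ : ContDiffBump t₀ := ⟨δ / 4, δ / 2, by positivity, by linarith⟩
  let b₂ : ContDiffBump s₀ := ⟨δ / 4, δ / 2, by positivity, by linarith⟩
  have hof : ContDiff ℝ ((⊤ : ℕ∞) : WithTop ℕ∞) (fun r : ℝ => (r : ℂ)) :=
    Complex.ofRealCLM.contDiff
  have hb : ∀ {x : E d} (b : ContDiffBump x), ContDiff ℝ ((⊤ : ℕ∞) : WithTop ℕ∞) (fun t => (b t : ℂ)) :=
    fun b => hof.comp b.contDiff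
  have hbs : ∀ {x : E d} (b : ContDiffBump x), HasCompactSupport (fun t => (b t : ℂ)) :=
    fun b => b.hasCompactSupport.comp_left (g := fun r : ℝ => (r : ℂ)) (by simp)
  have hsupp : ∀ z, δ ≤ dist z z₀ → b₁ (fstE z) * b₂ (sndE z) = 0 := by
    intro z hz
    by_contra! h
    have h1 : fstE z ∈ Metric.ball t₀ (δ / 2) := by
      have := b₁.support_eq
      rw [← this]
      exact left_ne_zero_of_mul h
    have h2 : sndE z ∈ Metric.ball s₀ (δ / 2) := by
      have := b₂.support_eq
      rw [← this]
      exact right_ne_zero_of_mul h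
    rw [Metric.mem_ball, dist_eq_norm] at h1 h2
    have h3 : dist z z₀ ≤ ‖fstE z - t₀‖ + ‖sndE z - s₀‖ := by
      rw [dist_eq_norm, ← pair_fstE_sndE z, ← pair_fstE_sndE z₀, pair_sub_pair]
      simp only [fstE_pair, sndE_pair]
      exact norm_pair_le _ _
    linarith
  have hγs : HasCompactSupport (fun z : E (d + d) => (b₁ (fstE z) * b₂ (sndE z) : ℝ)) := by
    refine HasCompactSupport.intro (isCompact_closedBall z₀ δ) fun z hz => hsupp z ?_
    rw [Metric.mem_closedBall, not_le] at hz
    exact hz.le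
  have hγc : ContDiff ℝ ((⊤ : ℕ∞) : WithTop ℕ∞)
      (fun z : E (d + d) => (b₁ (fstE z) * b₂ (sndE z) : ℝ)) :=
    (b₁.contDiff.comp contDiff_fstE).mul (b₂.contDiff.comp contDiff_sndE)
  let γ : 𝓢(E (d + d), ℂ) := HasCompactSupport.toSchwartzMap
    (f := fun z => ((b₁ (fstE z) * b₂ (sndE z) : ℝ) : ℂ))
    (hγs.comp_left (g := fun r : ℝ => (r : ℂ)) (by simp)) (hof.comp hγc)
  have hγ : ∀ z, γ z = ((b₁ (fstE z) * b₂ (sndE z) : ℝ) : ℂ) := fun z => rfl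
  refine ⟨γ, (hbs b₁).toSchwartzMap (hb b₁), (hbs b₂).toSchwartzMap (hb b₂), fun t s => ?_, ?_⟩
  · rw [hγ, fstE_pair, sndE_pair, Complex.ofReal_mul]
    rfl
  · set h : E (d + d) → ℝ :=
      fun z => (b₁ (fstE z) * b₂ (sndE z)) * (φ z₀ * (starRingEnd ℂ) (φ z)).re with hh
    have hre : (φ z₀ * ∫ z, γ z * (starRingEnd ℂ) (φ z)).re = ∫ z, h z := by
      have hint : Integrable fun z => φ z₀ * (γ z * (starRingEnd ℂ) (φ z)) := by
        refine Integrable.const_mul ?_ _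
        have := (γ.memLp 2 volume).integrable_mul ((conjS φ).memLp 2 volume)
        exact this
      rw [← integral_const_mul]
      have := integral_re hint
      simp only [RCLike.re_eq_complex_re] at this
      rw [← this]
      refine integral_congr_ae (ae_of_all _ fun z => ?_)
      simp only [hγ, hh]
      rw [mul_left_comm, Complex.re_ofReal_mul]
    have hpos' : 0 < ∫ z, h z := by
      refine Continuous.integral_pos_of_hasCompactSupport_nonneg_nonzero (x := z₀)
        (hγc.continuous.mul hcont) hγs.mul_right (fun z => ?_) ?_
      · by_cases hz : dist z z₀ < δ
        · exact mul_nonneg (mul_nonneg (b₁.nonneg' _) (b₂.nonneg' _)) (hball z hz).le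
        · simp only [hh, hsupp z (not_lt.1 hz), zero_mul, Pi.zero_apply, le_refl]
      · refine mul_ne_zero (mul_ne_zero ?_ ?_) hpos.ne'
        · exact (b₁.pos_of_mem_ball (Metric.mem_ball_self b₁.rOut_pos)).ne'
        · exact (b₂.pos_of_mem_ball (Metric.mem_ball_self b₂.rOut_pos)).ne'
    intro h0
    rw [h0, mul_zero] at hre
    rw [← hre] at hpos'
    exact lt_irrefl _ hpos'

/-! ### A mixed norm estimate -/

theorem sqrt_sq_ennreal (a : ℝ≥0∞) : (a ^ 2) ^ (1 / 2 : ℝ) = a := by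
  rw [← ENNReal.rpow_natCast, ← ENNReal.rpow_mul]
  norm_num

theorem sq_sqrt_ennreal (a : ℝ≥0∞) : (a ^ (1 / 2 : ℝ)) ^ 2 = a := by
  rw [← ENNReal.rpow_natCast, ← ENNReal.rpow_mul]
  norm_num

theorem lintegral_mul_le_sqrt {α : Type*} [MeasurableSpace α] {μ : Measure α} {f g : α → ℝ≥0∞}
    (hf : AEMeasurable f μ) (hg : AEMeasurable g μ) :
    ∫⁻ x, f x * g x ∂μ ≤ (∫⁻ x, f x ^ 2 ∂μ) ^ (1 / 2 : ℝ) * (∫⁻ x, g x ^ 2 ∂μ) ^ (1 / 2 : ℝ) := by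
  have h := ENNReal.lintegral_mul_norm_pow_le (hf.pow_const 2) (hg.pow_const 2)
    (p := 1 / 2) (q := 1 / 2) (by norm_num) (by norm_num) (by norm_num)
  simpa only [sqrt_sq_ennreal] using h

/-- Large values of `a` use `1 ≤ p`, small ones `p / 2 ≤ 1`. This splits an `L^p` function into a
part to pair with `L^∞` and a part to pair with `L²`. -/
theorem le_rpow_add_rpow_half {p : ℝ} (hp1 : 1 ≤ p) (hp2 : p ≤ 2) (a : ℝ≥0∞) :
    a ≤ a ^ p + a ^ (p / 2) := by
  rcases le_total 1 a with h | h
  · refine le_trans ?_ le_self_add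
    calc a = a ^ (1 : ℝ) := (ENNReal.rpow_one a).symm
      _ ≤ a ^ p := ENNReal.rpow_le_rpow_of_exponent_le h hp1
  · refine le_trans ?_ le_add_self
    calc a = a ^ (1 : ℝ) := (ENNReal.rpow_one a).symm
      _ ≤ a ^ (p / 2) := ENNReal.rpow_le_rpow_of_exponent_ge h (by linarith)

/-- For `1 ≤ p ≤ 2` a function in `L^{2,p}` pairs with functions in `L^{2,∞} ∩ L^{2,2}`. -/
theorem lintegral_mul_le_mixed {α β : Type*} [MeasurableSpace α] [MeasurableSpace β]
    {μ : Measure α} {ν : Measure β} [SFinite μ] [SFinite ν] {p : ℝ} (hp1 : 1 ≤ p) (hp2 : p ≤ 2)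
    {F G : α × β → ℝ≥0∞} (hF : Measurable F) (hG : Measurable G) {M₁ M₂ : ℝ≥0∞}
    (h₁ : ∀ z, ∫⁻ v, G (v, z) ^ 2 ∂μ ≤ M₁) (h₂ : ∫⁻ z, ∫⁻ v, G (v, z) ^ 2 ∂μ ∂ν ≤ M₂) :
    ∫⁻ q, F q * G q ∂(μ.prod ν) ≤
      (∫⁻ z, (∫⁻ v, F (v, z) ^ 2 ∂μ) ^ (p / 2) ∂ν) * M₁ ^ (1 / 2 : ℝ) +
      (∫⁻ z, (∫⁻ v, F (v, z) ^ 2 ∂μ) ^ (p / 2) ∂ν) ^ (1 / 2 : ℝ) * M₂ ^ (1 / 2 : ℝ) := by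
  set a : β → ℝ≥0∞ := fun z => (∫⁻ v, F (v, z) ^ 2 ∂μ) ^ (1 / 2 : ℝ) with ha
  set b : β → ℝ≥0∞ := fun z => (∫⁻ v, G (v, z) ^ 2 ∂μ) ^ (1 / 2 : ℝ) with hb
  have ham : Measurable a := ((hF.pow_const 2).lintegral_prod_left').pow_const _
  have hbm : Measurable b := ((hG.pow_const 2).lintegral_prod_left').pow_const _
  have hap : ∀ z, a z ^ p = (∫⁻ v, F (v, z) ^ 2 ∂μ) ^ (p / 2) := by
    intro z
    rw [ha, ← ENNReal.rpow_mul]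
    congr 1
    ring
  have hap2 : ∀ z, (a z ^ (p / 2)) ^ 2 = a z ^ p := by
    intro z
    rw [← ENNReal.rpow_natCast, ← ENNReal.rpow_mul]
    congr 1
    push_cast
    ring
  have hb2 : ∀ z, b z ^ 2 = ∫⁻ v, G (v, z) ^ 2 ∂μ := fun z => sq_sqrt_ennreal _
  have hbM : ∀ z, b z ≤ M₁ ^ (1 / 2 : ℝ) := fun z =>
    ENNReal.rpow_le_rpow (h₁ z) (by norm_num)
  simp_rw [← hap]
  calc ∫⁻ q, F q * G q ∂(μ.prod ν) = ∫⁻ z, ∫⁻ v, F (v, z) * G (v, z) ∂μ ∂ν :=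
        lintegral_prod_symm' _ (hF.mul hG)
    _ ≤ ∫⁻ z, a z * b z ∂ν := lintegral_mono fun z => lintegral_mul_le_sqrt
        (hF.comp (measurable_id.prodMk measurable_const)).aemeasurable
        (hG.comp (measurable_id.prodMk measurable_const)).aemeasurable
    -- The term with `a ^ p` is integrable and takes the uniform bound on `b`; the term with `a ^ (p
    -- / 2)` is square integrable and will be treated by Cauchy–Schwarz.
    _ ≤ ∫⁻ z, (a z ^ p * M₁ ^ (1 / 2 : ℝ) + a z ^ (p / 2) * b z) ∂ν := by
        refine lintegral_mono fun z => ?_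
        calc a z * b z ≤ (a z ^ p + a z ^ (p / 2)) * b z := by
              gcongr; exact le_rpow_add_rpow_half hp1 hp2 _
          _ = a z ^ p * b z + a z ^ (p / 2) * b z := add_mul _ _ _
          _ ≤ _ := by gcongr; exact hbM z
    _ = (∫⁻ z, a z ^ p ∂ν) * M₁ ^ (1 / 2 : ℝ) + ∫⁻ z, a z ^ (p / 2) * b z ∂ν := by
        rw [lintegral_add_left ((ham.pow_const _).mul_const _),
          lintegral_mul_const _ (ham.pow_const _)]
    _ ≤ _ := by
        gcongr
        refine (lintegral_mul_le_sqrt (ham.pow_const _).aemeasurable hbm.aemeasurable).trans ?_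
        simp_rw [hap2, hb2]
        gcongr

/-! ### The bounded functional on `L²` defined by a tempered distribution -/

/-- The right side of the inversion formula makes sense for every `ψ` in `L²`: the mixed estimate
applies with the uniform and the global `L²` bounds on the dual transform, both proportional to
`‖ψ‖²`. -/
theorem exists_bounded_form {d : ℕ} {p : ℝ} (hp1 : 1 ≤ p) (hp2 : p ≤ 2)
    {φ γ : 𝓢(E (d + d), ℂ)} {γ₁ γ₂ : 𝓢(E d, ℂ)} (hγ : ∀ t s, γ (pair t s) = γ₁ t * γ₂ s)
    {k : 𝓢'(E (d + d), ℂ)}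
    (hk : ∫⁻ z : E d × E d, (∫⁻ v : E d × E d, ‖gaborTransform φ k (mixPoint (v, z)).1
      (mixPoint (v, z)).2‖ₑ ^ 2) ^ (p / 2) < ∞) :
    ∃ B : L2 (d + d) →L[ℂ] ℂ, ∀ ψ : L2 (d + d),
      Integrable (fun w : E (d + d) × E (d + d) =>
        gaborTransform φ k w.1 w.2 * dualGabor γ ψ w) ∧
      B ψ = ∫ w : E (d + d) × E (d + d), gaborTransform φ k w.1 w.2 * dualGabor γ ψ w := by
  set S := ∫⁻ z : E d × E d, (∫⁻ v : E d × E d, ‖gaborTransform φ k (mixPoint (v, z)).1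
      (mixPoint (v, z)).2‖ₑ ^ 2) ^ (p / 2) with hS
  set c₁ := ‖γ₁.toLp 2 volume‖ₑ ^ 2 * ‖γ₂.toLp 2 volume‖ₑ ^ 2 with hc₁
  set c₂ := ‖γ.toLp 2 volume‖ₑ ^ 2 with hc₂
  set C := S * c₁ ^ (1 / 2 : ℝ) + S ^ (1 / 2 : ℝ) * c₂ ^ (1 / 2 : ℝ) with hC
  have hCtop : C < ∞ := by
    have h1 : c₁ < ∞ := ENNReal.mul_lt_top (ENNReal.pow_lt_top enorm_lt_top)
      (ENNReal.pow_lt_top enorm_lt_top)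
    have h2 : c₂ < ∞ := ENNReal.pow_lt_top enorm_lt_top
    refine ENNReal.add_lt_top.2 ⟨ENNReal.mul_lt_top hk ?_, ENNReal.mul_lt_top ?_ ?_⟩
    · exact ENNReal.rpow_lt_top_of_nonneg (by norm_num) h1.ne
    · exact ENNReal.rpow_lt_top_of_nonneg (by norm_num) hk.ne
    · exact ENNReal.rpow_lt_top_of_nonneg (by norm_num) h2.ne
  have hV := measurable_gaborTransform φ k
  have hmix := (measurePreserving_mixPoint d).measurable
  have hbound : ∀ ψ : L2 (d + d), ∫⁻ w : E (d + d) × E (d + d),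
      ‖gaborTransform φ k w.1 w.2 * dualGabor γ ψ w‖ₑ ≤ C * ‖ψ‖ₑ := by
    intro ψ
    have hD : Measurable (dualGabor γ ψ) := (continuous_dualGabor γ ψ).measurable
    have h := lintegral_mul_le_mixed (μ := volume) (ν := volume) hp1 hp2
      (hV.comp hmix).enorm (hD.comp hmix).enorm
      (lintegral_enorm_dualGabor_mixPoint_sq_le hγ ψ)
      (lintegral_lintegral_enorm_dualGabor_mixPoint_sq_le γ ψ)
    have hVD : Measurable fun w : E (d + d) × E (d + d) =>
        ‖gaborTransform φ k w.1 w.2 * dualGabor γ ψ w‖ₑ := (hV.mul hD).enorm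
    rw [← (measurePreserving_mixPoint d).lintegral_comp hVD]
    simp_rw [enorm_mul]
    refine h.trans (le_of_eq ?_)
    have e : ∀ a b : ℝ≥0∞, (a ^ 2 * b) ^ (1 / 2 : ℝ) = b ^ (1 / 2 : ℝ) * a := fun a b => by
      rw [ENNReal.mul_rpow_of_nonneg _ _ (by norm_num), sqrt_sq_ennreal, mul_comm]
    rw [e ‖ψ‖ₑ, e ‖ψ‖ₑ, hC, add_mul, mul_assoc, mul_assoc]
    rfl
  have hint : ∀ ψ : L2 (d + d), Integrable (fun w : E (d + d) × E (d + d) =>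
      gaborTransform φ k w.1 w.2 * dualGabor γ ψ w) := by
    intro ψ
    have hD : Measurable (dualGabor γ ψ) := (continuous_dualGabor γ ψ).measurable
    exact ⟨(hV.mul hD).aestronglyMeasurable,
      (hbound ψ).trans_lt (ENNReal.mul_lt_top hCtop enorm_lt_top)⟩
  let L : L2 (d + d) →ₗ[ℂ] ℂ :=
    { toFun := fun ψ => ∫ w : E (d + d) × E (d + d),
        gaborTransform φ k w.1 w.2 * dualGabor γ ψ w
      map_add' := by
        intro ψ₁ ψ₂
        rw [← integral_add (hint ψ₁) (hint ψ₂)]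
        refine integral_congr_ae (ae_of_all _ fun w => ?_)
        simp only [dualGabor_eq_inner, inner_add_right, mul_add]
      map_smul' := by
        intro r ψ
        rw [RingHom.id_apply, smul_eq_mul, ← integral_const_mul]
        refine integral_congr_ae (ae_of_all _ fun w => ?_)
        simp only [dualGabor_eq_inner, inner_smul_right]
        ring }
  refine ⟨L.mkContinuous C.toReal fun ψ => ?_, fun ψ => ⟨hint ψ, rfl⟩⟩
  have h1 : ‖L ψ‖ₑ ≤ C * ‖ψ‖ₑ := (enorm_integral_le_lintegral_enorm _).trans (hbound ψ)
  have h2 := ENNReal.toReal_mono (ENNReal.mul_lt_top hCtop enorm_lt_top).ne h1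
  rwa [ENNReal.toReal_mul, toReal_enorm, toReal_enorm] at h2

end

end MixedMod

namespace MixedMod

open Filter Topology

noncomputable section

/-! ### Sums over orthonormal sequences -/

/-- The exponents of `u` add up to `2 (p - 1) / p + (2 - p) / p = 1`. All exponents are nonnegative,
so the values `0` and `∞` need no exception. -/
theorem rpow_interpolate {p : ℝ} (hp1 : 1 ≤ p) (hp2 : p ≤ 2) (u h : ℝ≥0∞) :
    u * h = (u ^ 2) ^ ((p - 1) / p) * (u ^ (2 - p) * h ^ p) ^ (1 / p) := by
  have hp : 0 < p := by linarith
  rw [ENNReal.mul_rpow_of_nonneg _ _ (by positivity), ← ENNReal.rpow_mul, ← ENNReal.rpow_mul,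
    ← ENNReal.rpow_natCast, ← ENNReal.rpow_mul, ← mul_assoc, ← ENNReal.rpow_add_of_nonneg]
  · rw [mul_one_div_cancel hp.ne', ENNReal.rpow_one]
    have : ((2 : ℕ) : ℝ) * ((p - 1) / p) + (2 - p) * (1 / p) = 1 := by
      field_simp
      push_cast
      ring
    rw [this, ENNReal.rpow_one]
  · exact mul_nonneg (by norm_num) (div_nonneg (by linarith) hp.le)
  · exact mul_nonneg (by linarith) (by positivity)

/-- Hölder with weights `(p - 1) / p` and `1 / p` for the factorization above; the first factor is
kept as an `L²` norm of `u`, uniformly bounded along an orthonormal sequence. -/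
theorem lintegral_mul_rpow_le {β : Type*} [MeasurableSpace β] {ν : Measure β} {p : ℝ}
    (hp1 : 1 ≤ p) (hp2 : p ≤ 2) {u h : β → ℝ≥0∞} (hu : Measurable u) (hh : Measurable h) :
    (∫⁻ z, u z * h z ∂ν) ^ p ≤
      (∫⁻ z, u z ^ 2 ∂ν) ^ (p - 1) * ∫⁻ z, u z ^ (2 - p) * h z ^ p ∂ν := by
  have hp : 0 < p := by linarith
  have h1 := ENNReal.lintegral_mul_norm_pow_le (μ := ν) (hu.pow_const 2).aemeasurable
    ((hu.pow_const (2 - p)).mul (hh.pow_const p)).aemeasurable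
    (p := (p - 1) / p) (q := 1 / p) (div_nonneg (by linarith) hp.le) (by positivity)
    (by field_simp; ring)
  simp only [Pi.mul_apply, ← rpow_interpolate hp1 hp2] at h1
  refine (ENNReal.rpow_le_rpow h1 hp.le).trans (le_of_eq ?_)
  rw [ENNReal.mul_rpow_of_nonneg _ _ hp.le, ← ENNReal.rpow_mul, ← ENNReal.rpow_mul,
    div_mul_cancel₀ _ hp.ne', div_mul_cancel₀ _ hp.ne', ENNReal.rpow_one]

/-- Hölder for the counting measure with weights `(2 - p) / 2` and `p / 2`, chosen so that only sums
of squares remain. -/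
theorem tsum_rpow_mul_rpow_le {p : ℝ} (hp1 : 1 ≤ p) (hp2 : p ≤ 2) (u h : ℕ → ℝ≥0∞) :
    ∑' n, u n ^ (2 - p) * h n ^ p ≤
      (∑' n, u n ^ 2) ^ ((2 - p) / 2) * (∑' n, h n ^ 2) ^ (p / 2) := by
  have h1 := ENNReal.lintegral_mul_norm_pow_le (μ := Measure.count)
    (f := fun n => u n ^ 2) (g := fun n => h n ^ 2)
    (measurable_of_countable _).aemeasurable (measurable_of_countable _).aemeasurable
    (p := (2 - p) / 2) (q := p / 2) (by linarith) (by linarith) (by ring)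
  simp only [lintegral_count] at h1
  refine le_trans (le_of_eq (tsum_congr fun n => ?_)) h1
  rw [← ENNReal.rpow_natCast, ← ENNReal.rpow_natCast, ← ENNReal.rpow_mul, ← ENNReal.rpow_mul]
  congr 2 <;> (push_cast; ring)

/-- The core of the Schatten estimate: orthonormality enters only through the pointwise Bessel
bounds `ha` and `hc` and the normalization `hb`. -/
theorem tsum_lintegral_mul_rpow_le {β : Type*} [MeasurableSpace β] {ν : Measure β} {p : ℝ}
    (hp1 : 1 ≤ p) (hp2 : p ≤ 2) {u h : ℕ → β → ℝ≥0∞} (hu : ∀ n, Measurable (u n))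
    (hh : ∀ n, Measurable (h n)) {G : β → ℝ≥0∞} (hG : Measurable G) {a b c : ℝ≥0∞}
    (ha : ∀ z, ∑' n, u n z ^ 2 ≤ a) (hb : ∀ n, ∫⁻ z, u n z ^ 2 ∂ν ≤ b)
    (hc : ∀ z, ∑' n, h n z ^ 2 ≤ c * G z) :
    ∑' n, (∫⁻ z, u n z * h n z ∂ν) ^ p ≤
      b ^ (p - 1) * (a ^ ((2 - p) / 2) * (c ^ (p / 2) * ∫⁻ z, G z ^ (p / 2) ∂ν)) := by
  calc ∑' n, (∫⁻ z, u n z * h n z ∂ν) ^ p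
      ≤ ∑' n, b ^ (p - 1) * ∫⁻ z, u n z ^ (2 - p) * h n z ^ p ∂ν := by
        refine ENNReal.tsum_le_tsum fun n => (lintegral_mul_rpow_le hp1 hp2 (hu n) (hh n)).trans ?_
        gcongr
        · exact hb n
    _ = b ^ (p - 1) * ∫⁻ z, ∑' n, u n z ^ (2 - p) * h n z ^ p ∂ν := by
        have hm : ∀ n, AEMeasurable (fun z => u n z ^ (2 - p) * h n z ^ p) ν := fun n =>
          (((hu n).pow_const _).mul ((hh n).pow_const _)).aemeasurable
        rw [ENNReal.tsum_mul_left, lintegral_tsum hm]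
    _ ≤ b ^ (p - 1) * ∫⁻ z, a ^ ((2 - p) / 2) * (c ^ (p / 2) * G z ^ (p / 2)) ∂ν := by
        gcongr with z
        refine (tsum_rpow_mul_rpow_le hp1 hp2 _ _).trans ?_
        rw [← ENNReal.mul_rpow_of_nonneg _ _ (by linarith : 0 ≤ p / 2)]
        gcongr
        · exact ha z
        · exact hc z
    _ = _ := by
        rw [lintegral_const_mul _ ((hG.pow_const _).const_mul _),
          lintegral_const_mul _ (hG.pow_const _)]

/-- Test `L` on `x = ∑ conj (L (e n)) • e n`. With `s` the partial sum of squares, `L x = s` and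
`‖x‖² = s`, so `s² ≤ C s`. -/
theorem tsum_enorm_sq_le_of_bound {H : Type*} [NormedAddCommGroup H] [InnerProductSpace ℂ H]
    (L : H →ₗ[ℂ] ℂ) {C : ℝ≥0∞} (hL : ∀ x, ‖L x‖ₑ ^ 2 ≤ C * ‖x‖ₑ ^ 2) {e : ℕ → H}
    (he : Orthonormal ℂ e) : ∑' n, ‖L (e n)‖ₑ ^ 2 ≤ C := by
  refine ENNReal.tsum_le_of_sum_range_le fun N => ?_
  rcases eq_or_ne C ∞ with rfl | hC
  · exact le_top
  lift C to NNReal using hC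
  have hL' : ∀ x, ‖L x‖₊ ^ 2 ≤ C * ‖x‖₊ ^ 2 := fun x => by
    have := hL x
    simp only [enorm_eq_nnnorm] at this
    exact_mod_cast this
  suffices h : ∑ n ∈ Finset.range N, ‖L (e n)‖₊ ^ 2 ≤ C by
    simp only [enorm_eq_nnnorm]
    exact_mod_cast h
  set s := ∑ n ∈ Finset.range N, ‖L (e n)‖₊ ^ 2 with hs
  let x := ∑ n ∈ Finset.range N, (starRingEnd ℂ) (L (e n)) • e n
  have h1 : L x = ((s : ℝ) : ℂ) := by
    simp only [x, map_sum, map_smul, smul_eq_mul, hs, Complex.conj_mul']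
    push_cast
    rfl
  have h2 : ‖x‖₊ ^ 2 = s := by
    have h : inner ℂ x x = ((s : ℝ) : ℂ) := by
      rw [he.inner_sum]
      simp only [hs, Complex.conj_conj, Complex.mul_conj']
      push_cast
      rfl
    rw [inner_self_eq_norm_sq_to_K] at h
    rw [← NNReal.coe_inj]
    push_cast
    refine Complex.ofReal_injective ?_
    rw [← h]
    simp
  have h3 := hL' x
  have h4 : ‖L x‖₊ = s := by
    rw [h1]
    ext
    simp
  rw [h4, h2, sq] at h3
  rcases eq_or_ne s 0 with h0 | h0
  · rw [h0]; exact zero_le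
  · exact le_of_mul_le_mul_right h3 (pos_iff_ne_zero.2 h0)

theorem inner_star_star {α : Type*} [MeasurableSpace α] {μ : Measure α} (f g : Lp ℂ 2 μ) :
    inner ℂ (star f) (star g) = (inner ℂ g f : ℂ) := by
  rw [L2.inner_def, L2.inner_def]
  refine integral_congr_ae ?_
  filter_upwards [Lp.coeFn_star f, Lp.coeFn_star g] with x hf hg
  rw [hf, hg]
  simp [mul_comm]

/-- The kernel pairing is bilinear, so matrix coefficients involve the conjugates of the `g n`;
conjugation must not destroy orthonormality. -/
theorem orthonormal_star {α : Type*} [MeasurableSpace α] {μ : Measure α} {e : ℕ → Lp ℂ 2 μ}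
    (he : Orthonormal ℂ e) : Orthonormal ℂ fun n => star (e n) := by
  rw [orthonormal_iff_ite] at he ⊢
  intro i j
  rw [inner_star_star, he]
  simp [eq_comm]

theorem tsum_enorm_dualGabor_sq_le {n : ℕ} (γ : 𝓢(E n, ℂ)) {e : ℕ → L2 n}
    (he : Orthonormal ℂ e) (z : E n × E n) :
    ∑' j, ‖dualGabor γ (e j) z‖ₑ ^ 2 ≤ ‖γ.toLp 2 volume‖ₑ ^ 2 := by
  have h := tsum_enorm_sq_le_of_bound (innerSL ℂ (shiftL2 γ z)).toLinearMap
    (C := ‖γ.toLp 2 volume‖ₑ ^ 2) (fun x => ?_) he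
  · refine le_trans (le_of_eq (tsum_congr fun j => ?_)) h
    rw [dualGabor_eq_inner]
    rfl
  · have h1 : ‖shiftL2 γ z‖ₑ = ‖γ.toLp 2 volume‖ₑ := by
      rw [← ofReal_norm, norm_shiftL2, ofReal_norm]
    rw [← h1, ← mul_pow]
    gcongr
    rw [← ofReal_norm, ← ofReal_norm, ← ofReal_norm, ← ENNReal.ofReal_mul (norm_nonneg _)]
    exact ENNReal.ofReal_le_ofReal (norm_inner_le_norm (𝕜 := ℂ) (shiftL2 γ z) x)

/-- Bessel's inequality for the functional `x ↦ ∫ F * dualGabor γ x`, bounded by Cauchy–Schwarz. It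
will be applied to `F = V(·, z)` for each `z`, including those where this slice is not square
integrable. -/
theorem tsum_enorm_integral_mul_dualGabor_sq_le {n : ℕ} (γ : 𝓢(E n, ℂ)) {e : ℕ → L2 n}
    (he : Orthonormal ℂ e) {F : E n × E n → ℂ} (hF : Measurable F) :
    ∑' j, ‖∫ v, F v * dualGabor γ (e j) v‖ₑ ^ 2 ≤
      (‖γ.toLp 2 volume‖ₑ ^ 2 + 1) * ∫⁻ v, ‖F v‖ₑ ^ 2 := by
  -- The summand `1` in the constant keeps it nonzero, so that for non-square-integrable `F` the
  -- bound is `∞` even if `γ = 0`.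
  rcases eq_or_ne (∫⁻ v, ‖F v‖ₑ ^ 2) ∞ with h | h
  · rw [h, ENNReal.mul_top (by simp)]
    exact le_top
  have hb : ∀ x : L2 n, (∫⁻ v, ‖F v * dualGabor γ x v‖ₑ) ^ 2 ≤
      ((‖γ.toLp 2 volume‖ₑ ^ 2 + 1) * ∫⁻ v, ‖F v‖ₑ ^ 2) * ‖x‖ₑ ^ 2 := by
    intro x
    simp only [enorm_mul]
    refine (lintegral_mul_sq_le hF.enorm.aemeasurable
      (continuous_dualGabor γ x).measurable.enorm.aemeasurable).trans ?_
    calc (∫⁻ v, ‖F v‖ₑ ^ 2) * ∫⁻ v, ‖dualGabor γ x v‖ₑ ^ 2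
        ≤ (∫⁻ v, ‖F v‖ₑ ^ 2) * (‖x‖ₑ ^ 2 * (‖γ.toLp 2 volume‖ₑ ^ 2 + 1)) := by
          gcongr
          refine (lintegral_enorm_dualGabor_sq_le γ x).trans ?_
          gcongr
          exact le_self_add
      _ = _ := by ring
  have hint : ∀ x : L2 n, Integrable fun v => F v * dualGabor γ x v := by
    intro x
    refine ⟨(hF.mul (continuous_dualGabor γ x).measurable).aestronglyMeasurable, ?_⟩
    have h1 := (hb x).trans_lt (ENNReal.mul_lt_top (ENNReal.mul_lt_top (ENNReal.add_lt_top.2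
      ⟨ENNReal.pow_lt_top enorm_lt_top, ENNReal.one_lt_top⟩) h.lt_top)
      (ENNReal.pow_lt_top enorm_lt_top))
    exact (ENNReal.pow_lt_top_iff.1 h1).resolve_right two_ne_zero
  let L : L2 n →ₗ[ℂ] ℂ :=
    { toFun := fun x => ∫ v, F v * dualGabor γ x v
      map_add' := by
        intro x y
        rw [← integral_add (hint x) (hint y)]
        refine integral_congr_ae (ae_of_all _ fun w => ?_)
        simp only [dualGabor_eq_inner, inner_add_right, mul_add]
      map_smul' := by
        intro r x
        rw [RingHom.id_apply, smul_eq_mul, ← integral_const_mul]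
        refine integral_congr_ae (ae_of_all _ fun w => ?_)
        simp only [dualGabor_eq_inner, inner_smul_right]
        ring }
  refine tsum_enorm_sq_le_of_bound L (fun x => le_trans ?_ (hb x)) he
  gcongr
  exact enorm_integral_le_lintegral_enorm _

end

end MixedMod

namespace MixedMod

open Filter Topology

noncomputable section

/-! ### Kernels of integral operators -/

theorem exists_schwartz_of_contDiff {n : ℕ} {g : E n → ℝ} (hg : ContDiff ℝ (⊤ : ℕ∞) g)
    (hs : HasCompactSupport g) : ∃ ψ : 𝓢(E n, ℂ), ∀ x, ψ x = (g x : ℂ) := by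
  have h1 : HasCompactSupport fun x => (g x : ℂ) := hs.comp_left Complex.ofReal_zero
  have h2 : ContDiff ℝ (⊤ : ℕ∞) fun x => (g x : ℂ) := Complex.ofRealCLM.contDiff.comp hg
  exact ⟨h1.toSchwartzMap h2, fun x => rfl⟩

theorem locallyIntegrable_of_integrable_mul_schwartz {n : ℕ} {K : E n → ℂ}
    (hK : ∀ ψ : 𝓢(E n, ℂ), Integrable fun z => K z * ψ z) : LocallyIntegrable K := by
  intro x
  let b : ContDiffBump x := default
  obtain ⟨ψ, hψ⟩ := exists_schwartz_of_contDiff (b.contDiff (n := (⊤ : ℕ∞))) b.hasCompactSupport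
  refine ⟨Metric.closedBall x b.rIn, Metric.closedBall_mem_nhds x b.rIn_pos, ?_⟩
  refine ((hK ψ).integrableOn (s := Metric.closedBall x b.rIn)).congr_fun (fun z hz => ?_)
    measurableSet_closedBall
  change K z * ψ z = K z
  rw [hψ, b.one_of_mem_closedBall hz]
  simp

/-- A function representing a tempered distribution is unique almost everywhere, so an arbitrary
integral operator with kernel `k` can be computed with the `L²` kernel. -/
theorem ae_eq_of_integral_mul_schwartz_eq {n : ℕ} {K₁ K₂ : E n → ℂ}
    (h₁ : ∀ ψ : 𝓢(E n, ℂ), Integrable fun z => K₁ z * ψ z)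
    (h₂ : ∀ ψ : 𝓢(E n, ℂ), Integrable fun z => K₂ z * ψ z)
    (h : ∀ ψ : 𝓢(E n, ℂ), ∫ z, K₁ z * ψ z = ∫ z, K₂ z * ψ z) : K₁ =ᵐ[volume] K₂ := by
  refine ae_eq_of_integral_contDiff_smul_eq (locallyIntegrable_of_integrable_mul_schwartz h₁)
    (locallyIntegrable_of_integrable_mul_schwartz h₂) fun g hg hs => ?_
  obtain ⟨ψ, hψ⟩ := exists_schwartz_of_contDiff hg hs
  have := h ψ
  simp only [hψ] at this
  simpa only [Complex.real_smul, mul_comm] using this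

/-- The integral operator with an `L²` kernel. -/
def kernelOperator {d : ℕ} (K : L2 (d + d)) : L2 d →ₗ[ℂ] L2 d where
  toFun f := (memLp_kernel_integral (memLp_comp_pair (Lp.memLp K)) (Lp.memLp f)).toLp _
  map_add' f g := by
    rw [← MemLp.toLp_add, MemLp.toLp_eq_toLp_iff]
    filter_upwards [ae_integrable_kernel_mul (memLp_comp_pair (Lp.memLp K)) (Lp.memLp f),
      ae_integrable_kernel_mul (memLp_comp_pair (Lp.memLp K)) (Lp.memLp g)] with t hf hg
    rw [Pi.add_apply, ← integral_add hf hg]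
    refine integral_congr_ae ?_
    filter_upwards [Lp.coeFn_add f g] with y hy
    rw [hy, Pi.add_apply, mul_add]
  map_smul' r f := by
    rw [RingHom.id_apply, ← MemLp.toLp_const_smul, MemLp.toLp_eq_toLp_iff]
    refine ae_of_all _ fun t => ?_
    rw [Pi.smul_apply, smul_eq_mul, ← integral_const_mul]
    refine integral_congr_ae ?_
    filter_upwards [Lp.coeFn_smul r f] with y hy
    rw [hy, Pi.smul_apply, smul_eq_mul]
    ring

theorem integrable_L2_mul {n : ℕ} (K : L2 n) {f : E n → ℂ} (hf : MemLp f 2) :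
    Integrable fun z => K z * f z :=
  (Lp.memLp K).integrable_mul hf

theorem isIntegralOperator_kernelOperator {d : ℕ} {k : 𝓢'(E (d + d), ℂ)} {K : L2 (d + d)}
    (hK : ∀ ψ : 𝓢(E (d + d), ℂ), k ψ = ∫ z, K z * ψ z) :
    IsIntegralOperator k (kernelOperator K) := by
  refine ⟨K, Lp.aestronglyMeasurable K,
    fun ψ => ⟨integrable_L2_mul K (ψ.memLp 2 volume), hK ψ⟩, fun f => ?_⟩
  have h := memLp_kernel_integral (memLp_comp_pair (Lp.memLp K)) (Lp.memLp f)
  filter_upwards [ae_integrable_kernel_mul (memLp_comp_pair (Lp.memLp K)) (Lp.memLp f),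
    h.coeFn_toLp] with t h1 h2
  exact ⟨h1, h2⟩

theorem exists_tensor {d : ℕ} (g f : L2 d) : ∃ ψ : L2 (d + d),
    ∀ᵐ q : E d × E d, ψ (pair q.1 q.2) = g q.1 * f q.2 := by
  let e : (E d × E d) ≃ᵐ E (d + d) := glueE finSumFinEquiv
  have he : MeasurePreserving e := measurePreserving_glueE _
  have hm : MemLp (fun q : E d × E d => g q.1 * f q.2) 2 (volume : Measure (E d × E d)) :=
    memLp_mul_prod (Lp.memLp g) (Lp.memLp f)
  have hψ : MemLp (fun z => g (e.symm z).1 * f (e.symm z).2) 2 volume :=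
    hm.comp_measurePreserving (he.symm e)
  refine ⟨hψ.toLp _, ?_⟩
  filter_upwards [he.quasiMeasurePreserving.ae hψ.coeFn_toLp] with q hq
  rw [← glueE_finSumFinEquiv, hq]
  simp [e]

/-- Fubini for the `L²` kernel, after replacing the function in `hA` by it on almost every slice. -/
theorem inner_integralOperator {d : ℕ} {k : 𝓢'(E (d + d), ℂ)} {K : L2 (d + d)}
    (hK : ∀ ψ : 𝓢(E (d + d), ℂ), k ψ = ∫ z, K z * ψ z) {A : L2 d →ₗ[ℂ] L2 d}
    (hA : IsIntegralOperator k A) {f g : L2 d} {ψ : L2 (d + d)}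
    (hψ : ∀ᵐ q : E d × E d, ψ (pair q.1 q.2) = star g q.1 * f q.2) :
    inner ℂ g (A f) = ∫ z, K z * ψ z := by
  obtain ⟨K₁, -, h1, h2⟩ := hA
  have hK₁ : K₁ =ᵐ[volume] K := ae_eq_of_integral_mul_schwartz_eq (fun ψ => (h1 ψ).1)
    (fun ψ => integrable_L2_mul K (ψ.memLp 2 volume)) fun ψ => by rw [← hK, ← (h1 ψ).2]
  have hpair := (measurePreserving_pair d d).quasiMeasurePreserving.ae hK₁
  rw [Measure.volume_eq_prod] at hpair
  have hsec := Measure.ae_ae_of_ae_prod hpair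
  have hint : Integrable (fun q : E d × E d => K (pair q.1 q.2) * ψ (pair q.1 q.2)) :=
    ((measurePreserving_pair d d).integrable_comp_emb (measurableEmbedding_pair d d)).2
      (integrable_L2_mul K (Lp.memLp ψ))
  rw [← (measurePreserving_pair d d).integral_comp (measurableEmbedding_pair d d)
    (fun z => K z * ψ z)]
  rw [Measure.volume_eq_prod] at hψ hint ⊢
  rw [integral_prod _ hint, L2.inner_def]
  refine integral_congr_ae ?_
  filter_upwards [h2 f, hsec, Measure.ae_ae_of_ae_prod hψ, Lp.coeFn_star g] with t h3 h4 h5 h6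
  rw [h3.2, RCLike.inner_apply, mul_comm, ← integral_const_mul]
  refine integral_congr_ae ?_
  filter_upwards [h4, h5] with y h7 h8
  simp only [h7, h8, h6]
  simp only [Pi.star_apply, RCLike.star_def]
  ring

/-- The Riesz representative of `c⁻¹ • B` is conjugated because the kernel pairs bilinearly; on
Schwartz functions the inversion formula identifies the pairing with `k`. -/
theorem exists_L2_kernel {d : ℕ} {φ γ : 𝓢(E (d + d), ℂ)} {k : 𝓢'(E (d + d), ℂ)}
    (hc : ∫ z, γ z * (starRingEnd ℂ) (φ z) ≠ 0) {B : L2 (d + d) →L[ℂ] ℂ}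
    (hB : ∀ ψ : L2 (d + d), B ψ = ∫ w : E (d + d) × E (d + d),
      gaborTransform φ k w.1 w.2 * dualGabor γ ψ w) :
    ∃ K : L2 (d + d), (∀ ψ : L2 (d + d), ∫ z, K z * ψ z =
        (∫ z, γ z * (starRingEnd ℂ) (φ z))⁻¹ * B ψ) ∧
      ∀ ψ : 𝓢(E (d + d), ℂ), k ψ = ∫ z, K z * ψ z := by
  set c := ∫ z, γ z * (starRingEnd ℂ) (φ z)
  let κ := (InnerProductSpace.toDual ℂ (L2 (d + d))).symm (c⁻¹ • B)
  have h1 : ∀ ψ : L2 (d + d), ∫ z, (star κ : L2 (d + d)) z * ψ z = c⁻¹ * B ψ := by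
    intro ψ
    have h : inner ℂ κ ψ = (c⁻¹ • B) ψ := InnerProductSpace.toDual_symm_apply
    rw [smul_apply, smul_eq_mul] at h
    rw [← h, L2.inner_def]
    refine integral_congr_ae ?_
    filter_upwards [Lp.coeFn_star κ] with z hz
    rw [hz, RCLike.inner_apply, mul_comm]
    rfl
  refine ⟨star κ, h1, fun ψ => ?_⟩
  have h2 := h1 (ψ.toLp 2 volume)
  have h3 : ∫ z, (star κ : L2 (d + d)) z * ψ z =
      ∫ z, (star κ : L2 (d + d)) z * (ψ.toLp 2 volume) z := by
    refine integral_congr_ae ?_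
    filter_upwards [ψ.coeFn_toLp 2 volume] with z hz
    rw [hz]
  have h4 := integral_gaborTransform_mul_dualGabor φ γ k ψ
  rw [h3, h2, hB]
  simp only [dualGabor_congr γ (ψ.coeFn_toLp 2 volume)]
  rw [h4, inv_mul_cancel_left₀ hc]

/-- The absolute value enters the `z` integral but stays outside the `v` integral, which must remain
linear in `g` for Bessel's inequality to apply. -/
theorem enorm_form_tensor_le {d : ℕ} {φ γ : 𝓢(E (d + d), ℂ)} {γ₁ γ₂ : 𝓢(E d, ℂ)}
    (hγ : ∀ t s, γ (pair t s) = γ₁ t * γ₂ s) {k : 𝓢'(E (d + d), ℂ)} {ψ : L2 (d + d)}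
    {g f : L2 d} (hψ : ∀ᵐ q : E d × E d, ψ (pair q.1 q.2) = g q.1 * f q.2)
    (hint : Integrable (fun w : E (d + d) × E (d + d) =>
        gaborTransform φ k w.1 w.2 * dualGabor γ ψ w)) :
    ‖∫ w : E (d + d) × E (d + d), gaborTransform φ k w.1 w.2 * dualGabor γ ψ w‖ₑ ≤
      ∫⁻ z : E d × E d, ‖dualGabor γ₂ f z‖ₑ * ‖∫ v : E d × E d,
        gaborTransform φ k (mixPoint (v, z)).1 (mixPoint (v, z)).2 * dualGabor γ₁ g v‖ₑ := by
  have hint' : Integrable (fun q : (E d × E d) × (E d × E d) =>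
      gaborTransform φ k (mixPoint q).1 (mixPoint q).2 * dualGabor γ ψ (mixPoint q)) :=
    ((measurePreserving_mixPoint d).integrable_comp_emb
    (measurableEmbedding_mixPoint d)).2 hint
  rw [← (measurePreserving_mixPoint d).integral_comp (measurableEmbedding_mixPoint d)]
  rw [Measure.volume_eq_prod] at hint' ⊢
  rw [integral_prod_symm _ hint']
  refine (enorm_integral_le_lintegral_enorm _).trans (le_of_eq (lintegral_congr fun z => ?_))
  rw [← enorm_mul, ← integral_const_mul]
  congr 1
  refine integral_congr_ae (ae_of_all _ fun v => ?_)
  simp only [dualGabor_mul_mixPoint hγ hψ]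
  ring

theorem schattenNorm_lt_top_of_bound {H : Type*} [NormedAddCommGroup H] [InnerProductSpace ℂ H]
    {p : ℝ} (hp : 0 < p) {A : H →ₗ[ℂ] H} {C : ℝ≥0∞} (hC : C < ∞)
    (h : ∀ f g : ℕ → H, Orthonormal ℂ f → Orthonormal ℂ g →
      ∑' n, ‖(inner ℂ (g n) (A (f n)) : ℂ)‖ₑ ^ p ≤ C) : schattenNorm p A < ∞ := by
  refine lt_of_le_of_lt (b := C ^ (1 / p)) ?_ (ENNReal.rpow_lt_top_of_nonneg (by positivity) hC.ne)
  exact iSup_le fun f => iSup_le fun g => iSup_le fun hf => iSup_le fun hg =>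
    ENNReal.rpow_le_rpow (h f g hf hg) (by positivity)

theorem tsum_enorm_form_rpow_le {d : ℕ} {p : ℝ} (hp1 : 1 ≤ p) (hp2 : p ≤ 2)
    (φ : 𝓢(E (d + d), ℂ)) (γ₁ γ₂ : 𝓢(E d, ℂ)) (k : 𝓢'(E (d + d), ℂ)) {f g : ℕ → L2 d}
    (hf : Orthonormal ℂ f) (hg : Orthonormal ℂ g) :
    ∑' n, (∫⁻ z : E d × E d, ‖dualGabor γ₂ (f n) z‖ₑ * ‖∫ v : E d × E d,
        gaborTransform φ k (mixPoint (v, z)).1 (mixPoint (v, z)).2 *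
          dualGabor γ₁ (g n) v‖ₑ) ^ p ≤
      (‖γ₂.toLp 2 volume‖ₑ ^ 2) ^ (p - 1) * ((‖γ₂.toLp 2 volume‖ₑ ^ 2) ^ ((2 - p) / 2) *
        ((‖γ₁.toLp 2 volume‖ₑ ^ 2 + 1) ^ (p / 2) *
        ∫⁻ z : E d × E d, (∫⁻ v : E d × E d, ‖gaborTransform φ k (mixPoint (v, z)).1
          (mixPoint (v, z)).2‖ₑ ^ 2) ^ (p / 2))) := by
  have hV : Measurable fun q : (E d × E d) × (E d × E d) =>
      gaborTransform φ k (mixPoint q).1 (mixPoint q).2 :=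
    (measurable_gaborTransform φ k).comp (measurePreserving_mixPoint d).measurable
  refine tsum_lintegral_mul_rpow_le hp1 hp2
    (fun n => (continuous_dualGabor γ₂ (f n)).measurable.enorm) (fun n => ?_) ?_
    (tsum_enorm_dualGabor_sq_le γ₂ hf) (fun n => ?_) (fun z => ?_)
  · have hm : StronglyMeasurable fun q : (E d × E d) × (E d × E d) =>
        gaborTransform φ k (mixPoint q).1 (mixPoint q).2 * dualGabor γ₁ (g n) q.1 :=
      (hV.mul ((continuous_dualGabor γ₁ (g n)).measurable.comp measurable_fst)).stronglyMeasurable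
    exact hm.integral_prod_left'.measurable.enorm
  · exact (hV.enorm.pow_const 2).lintegral_prod_left'
  · refine (lintegral_enorm_dualGabor_sq_le γ₂ (f n)).trans (le_of_eq ?_)
    rw [← ofReal_norm, hf.1 n]
    simp
  · exact tsum_enorm_integral_mul_dualGabor_sq_le γ₁ hg
      (hV.comp (measurable_id.prodMk measurable_const))

end

end MixedMod

/-! ### Assembling the kernel and the Schatten bound -/

theorem corollary5p1 (d : ℕ) (c : Equiv.Perm (Fin ((d + d) + (d + d))))
    (hc : MixedMod.IsSlicePermutation d c) (p : ℝ) (hp1 : 1 ≤ p) (hp2 : p ≤ 2)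
    (φ : 𝓢(MixedMod.E (d + d), ℂ)) (hφ : φ ≠ 0)
    (k : 𝓢'(MixedMod.E (d + d), ℂ))
    (hk : k ∈ MixedMod.mixedModulationSpace φ c
      (Fin.append (fun _ : Fin (d + d) => (2 : ℝ≥0∞))
        (fun _ : Fin (d + d) => ENNReal.ofReal p))) :
    (∃ A : MixedMod.L2 d →ₗ[ℂ] MixedMod.L2 d, MixedMod.IsIntegralOperator k A) ∧
      ∀ A : MixedMod.L2 d →ₗ[ℂ] MixedMod.L2 d, MixedMod.IsIntegralOperator k A →
        MixedMod.IsSchatten p A := by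
  have hp : 0 < p := by linarith
  have hS := MixedMod.lintegral_gaborTransform_mixPoint_lt_top hc hp hk
  obtain ⟨γ, γ₁, γ₂, hγ, h0⟩ := MixedMod.exists_tensor_window hφ
  obtain ⟨B, hB⟩ := MixedMod.exists_bounded_form hp1 hp2 hγ hS
  obtain ⟨K, hK, hkK⟩ := MixedMod.exists_L2_kernel h0 fun ψ => (hB ψ).2
  refine ⟨⟨_, MixedMod.isIntegralOperator_kernelOperator hkK⟩, fun A hA => ?_⟩
  set c₀ := ∫ z, γ z * (starRingEnd ℂ) (φ z)
  have hfin : ‖c₀⁻¹‖ₑ ^ p * ((‖γ₂.toLp 2 volume‖ₑ ^ 2) ^ (p - 1) *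
      ((‖γ₂.toLp 2 volume‖ₑ ^ 2) ^ ((2 - p) / 2) * ((‖γ₁.toLp 2 volume‖ₑ ^ 2 + 1) ^ (p / 2) *
        ∫⁻ z : MixedMod.E d × MixedMod.E d, (∫⁻ v : MixedMod.E d × MixedMod.E d,
          ‖MixedMod.gaborTransform φ k (MixedMod.mixPoint (v, z)).1
          (MixedMod.mixPoint (v, z)).2‖ₑ ^ 2) ^ (p / 2)))) < ∞ := by
    have h2 : ‖γ₂.toLp 2 volume‖ₑ ^ 2 ≠ ∞ := (ENNReal.pow_lt_top enorm_lt_top).ne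
    have h1 : ‖γ₁.toLp 2 volume‖ₑ ^ 2 + 1 ≠ ∞ :=
      ENNReal.add_ne_top.2 ⟨(ENNReal.pow_lt_top enorm_lt_top).ne, ENNReal.one_ne_top⟩
    refine ENNReal.mul_lt_top ?_ (ENNReal.mul_lt_top ?_ (ENNReal.mul_lt_top ?_
      (ENNReal.mul_lt_top ?_ hS)))
    · exact ENNReal.rpow_lt_top_of_nonneg hp.le enorm_ne_top
    · exact ENNReal.rpow_lt_top_of_nonneg (by linarith) h2
    · exact ENNReal.rpow_lt_top_of_nonneg (by linarith) h2
    · exact ENNReal.rpow_lt_top_of_nonneg (by linarith) h1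
  refine MixedMod.schattenNorm_lt_top_of_bound hp hfin fun f g hf hg => ?_
  -- The estimate is applied to the conjugated sequence, because `inner ℂ (g n) (A (f n))` is the
  -- form evaluated at `star (g n) ⊗ f n`.
  refine le_trans ?_ (mul_le_mul_right (MixedMod.tsum_enorm_form_rpow_le hp1 hp2 φ γ₁ γ₂ k hf
    (MixedMod.orthonormal_star hg)) _)
  rw [← ENNReal.tsum_mul_left]
  refine ENNReal.tsum_le_tsum fun n => ?_
  obtain ⟨ψ, hψ⟩ := MixedMod.exists_tensor (star (g n)) (f n)
  rw [MixedMod.inner_integralOperator hkK hA hψ, hK, enorm_mul,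
    ENNReal.mul_rpow_of_nonneg _ _ hp.le, (hB ψ).2]
  gcongr
  exact MixedMod.enorm_form_tensor_le hγ hψ (hB ψ).1
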